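/- Let $A,J\in\mathbb{R}^{n\times n}$, $B_c\in\mathbb{R}^{n\times m_c}$, $B_d\in\mathbb{R}^{n\times m_d}$ and $\bar T>0$. Consider the controlled impulsive system $$\dot x(t)=Ax(t)+B_cu_c(t)\ (t\neq t_k),\qquad x(t_k^+)=Jx(t_k)+B_du_d(t_k),$$ with left-continuous trajectories and constant dwell-time, $t_{k+1}-t_k=\bar T$ for all $k\in\{0,1,2,\dots\}$, and the state feedback $$u_c(t_k+\tau)=K_c(\tau)x(t_k+\tau),\ \tau\in(0,\bar T],\qquad u_d(t_k)=K_dx(t_k),\tag{1}$$ where $K_c:[0,\bar T]\to\mathbb{R}^{m_c\times n}$ is continuous and $K_d\in\mathbb{R}^{m_d\times n}$. The closed loop is called positive if, for every initial time $s\ge t_0$, $x(s)\ge0$ implies $x(t)\ge 0$ for all $t\ge s$; it is called asymptotically stable if, for every initial time $s\ge t_0$, its zero solution is Lyapunov stable and all its trajectories converge to zero. Inequalities between vectors or matrices are entrywise, $\mathbb{1}$ is the vector of ones, and a matrix is Metzler if its off-diagonal entries are nonnegative. The following statements are equivalent. (a) There is a controller of the form (1) such that the closed loop is positive and asymptotically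 stable under constant dwell-time $\bar T$. (b) There are a vector $\lambda>0$ in $\mathbb{R}^n$, a continuous $K_c:[0,\bar T]\to\mathbb{R}^{m_c\times n}$ and a matrix $K_d\in\mathbb{R}^{m_d\times n}$ such that $A+B_cK_c(\tau)$ is Metzler for all $\tau\in[0,\bar T]$, $J+B_dK_d\ge0$ and $$[(J+B_dK_d)\Psi(\bar T)-I]\lambda<0,$$ where $\Psi'(s)=(A+B_cK_c(s))\Psi(s)$ on $[0,\bar T]$ and $\Psi(0)=I$. (c) There are a differentiable function $X$ from $[0,\bar T]$ to the diagonal $n\times n$ matrices, with $X(\tau)$ invertible for all $\tau\in[0,\bar T]$ and with $X(0)$ having positive diagonal entries, a continuous $U:[0,\bar T]\to\mathbb{R}^{m_c\times n}$, a matrix $U_d\in\mathbb{R}^{m_d\times n}$ and scalars $\varepsilon,\alpha>0$ such that, for all $\tau\in[0,\bar T]$, $$AX(\tau)+B_cU(\tau)+\alpha I\ge0,\quad JX(\bar T)+B_dU_d\ge0,$$ $$[-\dot X(\tau)+AX(\tau)+B_cU(\tau)]\mathbb{1}<0,\quad [JX(\bar T)+B_dU_d-X(0)+\varepsilon I]\mathbb{1}\le0.$$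 (d) There are a differentiable function $X$ from $[0,\bar T]$ to the diagonal $n\times n$ matrices, with $X(\tau)$ invertible for all $\tau\in[0,\bar T]$ and with $X(\bar T)$ having positive diagonal entries, a continuous $U:[0,\bar T]\to\mathbb{R}^{m_c\times n}$, a matrix $U_d\in\mathbb{R}^{m_d\times n}$ and scalars $\varepsilon,\alpha>0$ such that, for all $\tau\in[0,\bar T]$, $$AX(\tau)+B_cU(\tau)+\alpha I\ge0,\quad JX(0)+B_dU_d\ge0,$$ $$[\dot X(\tau)+AX(\tau)+B_cU(\tau)]\mathbb{1}<0,\quad [JX(0)+B_dU_d-X(\bar T)+\varepsilon I]\mathbb{1}\le0.$$ Moreover, for every solution of the conditions in (c), the gains $K_c(\tau)=U(\tau)X(\tau)^{-1}$ and $K_d=U_dX(\bar T)^{-1}$ make the closed loop positive and asymptotically stable under constant dwell-time $\bar T$; for every solution of the conditions in (d), the same holds for the gains $K_c(\tau)=U(\bar T-\tau)X(\bar T-\tau)^{-1}$ and $K_d=U_dX(0)^{-1}$. -/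

import Mathlib

open Set Filter Topology

/-- The data of the controlled linear impulsive system
`x'(t) = A x(t) + B_c u_c(t)` for `t ≠ t_k`, `x(t⁺) = J x(t) + B_d u_d(t)` for `t = t_k`. -/
structure ImpulsiveSystem (n mc md : ℕ) where
  A : Matrix (Fin n) (Fin n) ℝ
  Bc : Matrix (Fin n) (Fin mc) ℝ
  J : Matrix (Fin n) (Fin n) ℝ
  Bd : Matrix (Fin n) (Fin md) ℝ

/-- All off-diagonal entries are nonnegative. -/
def Matrix.IsMetzler {n : ℕ} (M : Matrix (Fin n) (Fin n) ℝ) : Prop :=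
  ∀ i j, i ≠ j → 0 ≤ M i j

/-- All entries are nonnegative. -/
def Matrix.IsNonneg {m n : ℕ} (M : Matrix (Fin m) (Fin n) ℝ) : Prop :=
  ∀ i j, 0 ≤ M i j

/-- Diagonal with positive diagonal entries. -/
def Matrix.IsPosDiag {n : ℕ} (M : Matrix (Fin n) (Fin n) ℝ) : Prop :=
  M.IsDiag ∧ ∀ i, 0 < M i i

/-- `M'` is the (entrywise) derivative of the matrix-valued function `M` on `[0, T]`
(one-sided at the end points). -/
def HasMatrixDerivOn {m n : ℕ} (T : ℝ) (M M' : ℝ → Matrix (Fin m) (Fin n) ℝ) : Prop :=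
  ∀ τ ∈ Icc 0 T, ∀ i j, HasDerivWithinAt (fun σ => M σ i j) (M' τ i j) (Icc 0 T) τ

/-- The impulse times `t 0, t 1, …` have constant dwell-time `T`. -/
def ConstantDwellTime (T : ℝ) (t : ℕ → ℝ) : Prop :=
  ∀ k, t (k + 1) - t k = T

namespace ImpulsiveSystem

variable {n mc md : ℕ} (S : ImpulsiveSystem n mc md)

/-- `x` is a (left-continuous) trajectory of the controlled system with impulse times `t k`,
started at time `s`, under the inputs `uc` and `ud`. If the starting time is an impulse time,
then `x s` is the state just before the jump. -/
structure IsTrajectory (t : ℕ → ℝ) (s : ℝ) (uc : ℝ → Fin mc → ℝ) (ud : ℝ → Fin md → ℝ)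
    (x : ℝ → Fin n → ℝ) : Prop where
  flow : ∀ r, s < r → (∀ k, r ≠ t k) →
    HasDerivAt x (S.A.mulVec (x r) + S.Bc.mulVec (uc r)) r
  left_cont : ∀ r, s < r → ContinuousWithinAt x (Iic r) r
  jump : ∀ k, s ≤ t k →
    Tendsto x (𝓝[>] (t k)) (𝓝 (S.J.mulVec (x (t k)) + S.Bd.mulVec (ud (t k))))
  start : (∀ k, s ≠ t k) → ContinuousWithinAt x (Ici s) s

/-- `x` is a trajectory of the closed loop obtained with the clock-dependent state feedback
`u_c(t_k + τ) = K_c(τ) x(t_k + τ)`, `τ ∈ (0, t_{k+1} - t_k]`, and `u_d(t_k) = K_d x(t_k)`. -/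
def IsClosedLoopTrajectory (Kc : ℝ → Matrix (Fin mc) (Fin n) ℝ) (Kd : Matrix (Fin md) (Fin n) ℝ)
    (t : ℕ → ℝ) (s : ℝ) (x : ℝ → Fin n → ℝ) : Prop :=
  ∃ (uc : ℝ → Fin mc → ℝ) (ud : ℝ → Fin md → ℝ),
    S.IsTrajectory t s uc ud x ∧
    (∀ k, ∀ r ∈ Ioc (t k) (t (k + 1)), s ≤ r → uc r = (Kc (r - t k)).mulVec (x r)) ∧
    (∀ k, s ≤ t k → ud (t k) = Kd.mulVec (x (t k)))

/-- The closed loop is positive under constant dwell-time `T`: a trajectory that starts,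
at any time, in the nonnegative orthant stays there. -/
def ClosedLoopPositive (T : ℝ) (Kc : ℝ → Matrix (Fin mc) (Fin n) ℝ)
    (Kd : Matrix (Fin md) (Fin n) ℝ) : Prop :=
  ∀ t, ConstantDwellTime T t → ∀ s, t 0 ≤ s → ∀ x, S.IsClosedLoopTrajectory Kc Kd t s x →
    0 ≤ x s → ∀ r, s ≤ r → 0 ≤ x r

/-- The zero solution of the closed loop is asymptotically stable under constant dwell-time `T`:
it is Lyapunov stable, and every trajectory converges to it. -/
def ClosedLoopAsymptoticallyStable (T : ℝ) (Kc : ℝ → Matrix (Fin mc) (Fin n) ℝ)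
    (Kd : Matrix (Fin md) (Fin n) ℝ) : Prop :=
  ∀ t, ConstantDwellTime T t → ∀ s, t 0 ≤ s →
    (∀ ε > 0, ∃ δ > 0, ∀ x, S.IsClosedLoopTrajectory Kc Kd t s x →
      ‖x s‖ < δ → ∀ r, s ≤ r → ‖x r‖ < ε) ∧
    (∀ x, S.IsClosedLoopTrajectory Kc Kd t s x → Tendsto x atTop (𝓝 0))

/-- `(K_c, K_d)` is an admissible controller (continuous on the clock interval) for which the
closed loop is positive and asymptotically stable under constant dwell-time `T`. -/
def IsStabilizing (T : ℝ) (Kc : ℝ → Matrix (Fin mc) (Fin n) ℝ)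
    (Kd : Matrix (Fin md) (Fin n) ℝ) : Prop :=
  ContinuousOn Kc (Icc 0 T) ∧ S.ClosedLoopPositive T Kc Kd ∧
    S.ClosedLoopAsymptoticallyStable T Kc Kd

/-- `Ψ` is the state-transition matrix on `[0, T]`: `Ψ' = (A + B_c K_c) Ψ`, `Ψ(0) = I`. -/
def IsTransitionMatrix (T : ℝ) (Kc : ℝ → Matrix (Fin mc) (Fin n) ℝ)
    (Ψ : ℝ → Matrix (Fin n) (Fin n) ℝ) : Prop :=
  Ψ 0 = 1 ∧ HasMatrixDerivOn T Ψ (fun τ => (S.A + S.Bc * Kc τ) * Ψ τ)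

/-- The linear program with decision variables `X`, `U`, `U_d`, `ε`, `α`, in the form in which
`X(0)` is positive. -/
structure ForwardLP (T : ℝ) (X : ℝ → Matrix (Fin n) (Fin n) ℝ)
    (U : ℝ → Matrix (Fin mc) (Fin n) ℝ) (Ud : Matrix (Fin md) (Fin n) ℝ) (ε α : ℝ) : Prop where
  eps_pos : 0 < ε
  alpha_pos : 0 < α
  diag : ∀ τ ∈ Icc 0 T, (X τ).IsDiag
  invertible : ∀ τ ∈ Icc 0 T, IsUnit (X τ)
  pos : (X 0).IsPosDiag
  cont : ContinuousOn U (Icc 0 T)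
  metzler : ∀ τ ∈ Icc 0 T,
    (S.A * X τ + S.Bc * U τ + α • (1 : Matrix (Fin n) (Fin n) ℝ)).IsNonneg
  nonneg : (S.J * X T + S.Bd * Ud).IsNonneg
  flow : ∃ X' : ℝ → Matrix (Fin n) (Fin n) ℝ, HasMatrixDerivOn T X X' ∧
    ∀ τ ∈ Icc 0 T, ∀ i, (-X' τ + S.A * X τ + S.Bc * U τ).mulVec 1 i < 0
  jump : ∀ i, (S.J * X T + S.Bd * Ud - X 0
    + ε • (1 : Matrix (Fin n) (Fin n) ℝ)).mulVec 1 i ≤ 0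

/-- The linear program with decision variables `X`, `U`, `U_d`, `ε`, `α`, in the form in which
`X(T)` is positive. -/
structure BackwardLP (T : ℝ) (X : ℝ → Matrix (Fin n) (Fin n) ℝ)
    (U : ℝ → Matrix (Fin mc) (Fin n) ℝ) (Ud : Matrix (Fin md) (Fin n) ℝ) (ε α : ℝ) : Prop where
  eps_pos : 0 < ε
  alpha_pos : 0 < α
  diag : ∀ τ ∈ Icc 0 T, (X τ).IsDiag
  invertible : ∀ τ ∈ Icc 0 T, IsUnit (X τ)
  pos : (X T).IsPosDiag
  cont : ContinuousOn U (Icc 0 T)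
  metzler : ∀ τ ∈ Icc 0 T,
    (S.A * X τ + S.Bc * U τ + α • (1 : Matrix (Fin n) (Fin n) ℝ)).IsNonneg
  nonneg : (S.J * X 0 + S.Bd * Ud).IsNonneg
  flow : ∃ X' : ℝ → Matrix (Fin n) (Fin n) ℝ, HasMatrixDerivOn T X X' ∧
    ∀ τ ∈ Icc 0 T, ∀ i, (X' τ + S.A * X τ + S.Bc * U τ).mulVec 1 i < 0
  jump : ∀ i, (S.J * X 0 + S.Bd * Ud - X T
    + ε • (1 : Matrix (Fin n) (Fin n) ℝ)).mulVec 1 i ≤ 0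

end ImpulsiveSystem

/-! Write `N = J + B_d K_d` and let `ξ(τ)` be the diagonal of `X(τ)`. With the gains `U X⁻¹`, the
program (c) says that the closed-loop flow matrix is Metzler, that `N ≥ 0`, that `ξ` is a strict
supersolution of the flow, and that `N ξ(T) ≤ ξ(0) - ε𝟙`. Invertibility forces `ξ > 0` on the whole
interval, so the last inequality gives `N ξ(T) ≤ ρ ξ(0)` with some `ρ < 1`. The order interval `-cξ
≤ x ≤ cξ` is then preserved along the flow and shrinks by the factor `ρ` at every jump. This gives
exponential decay, and the same comparison with `c = 0` gives positivity.
`Matrix.IsMetzler.nonneg_of_deriv` is the comparison principle and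
`IsContractiveSupersolution.propagate` iterates it.

From (b), `ξ(τ) = Ψ(τ)λ + δ e^{cτ}𝟙` solves (c): the exponential term makes the differential
inequality strict, and a small `δ` keeps the jump inequality (`exists_forwardLP`).

For (a) ⇒ (b), positivity and stability speak of all trajectories, so trajectories must first be
shown to exist; they are glued from solutions on clock intervals. Unit initial vectors then reveal
the signs of the entries of `N` and of the flow matrix. Convergence to zero gives `(N Ψ(T))^k 𝟙 →
0`, and a partial geometric sum of these vectors is the required `λ`.

Replacing `τ` by `T - τ` exchanges (c) and (d). -/

/-! ### Linear differential equations with continuous coefficients -/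

/-- The entries of a continuous matrix function are bounded on a compact interval. -/
lemma Matrix.exists_forall_abs_apply_le {m n : ℕ} {M : ℝ → Matrix (Fin m) (Fin n) ℝ} {a b : ℝ}
    (hM : ContinuousOn M (Icc a b)) : ∃ C > 0, ∀ t ∈ Icc a b, ∀ i j, |M t i j| ≤ C := by
  have h : ContinuousOn (fun t => (fun i j => M t i j : Fin m → Fin n → ℝ)) (Icc a b) := hM
  obtain ⟨C, hC⟩ := isCompact_Icc.exists_bound_of_continuousOn h
  refine ⟨max C 1, by positivity, fun t ht i j => le_trans ?_ (le_max_left _ _)⟩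
  exact ((norm_le_pi_norm (fun j => M t i j) j).trans
    (norm_le_pi_norm (fun i j => M t i j) i)).trans (hC t ht)

lemma Matrix.norm_mulVec_le_of_abs_apply_le {n : ℕ} {M : Matrix (Fin n) (Fin n) ℝ} {C : ℝ}
    (hC : 0 ≤ C) (hM : ∀ i j, |M i j| ≤ C) (x : Fin n → ℝ) : ‖M.mulVec x‖ ≤ n * C * ‖x‖ := by
  refine (pi_norm_le_iff_of_nonneg (by positivity)).2 fun i => ?_
  calc ‖M.mulVec x i‖ ≤ ∑ j, ‖M i j * x j‖ := by
        rw [Matrix.mulVec, dotProduct]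
        exact norm_sum_le _ _
    _ ≤ ∑ _j : Fin n, C * ‖x‖ := by
        refine Finset.sum_le_sum fun j _ => ?_
        rw [norm_mul]
        exact mul_le_mul (hM i j) (norm_le_pi_norm x j) (norm_nonneg _) hC
    _ = n * C * ‖x‖ := by simp [mul_assoc]

/-- **Global existence** for linear differential equations with continuous coefficients. -/
theorem exists_hasDerivWithinAt_mulVec {n : ℕ} {M : ℝ → Matrix (Fin n) (Fin n) ℝ} {a b : ℝ}
    (hab : a ≤ b) (hM : ContinuousOn M (Icc a b)) (x₀ : Fin n → ℝ) :
    ∃ y : ℝ → Fin n → ℝ, y a = x₀ ∧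
      ∀ t ∈ Icc a b, HasDerivWithinAt y ((M t).mulVec (y t)) (Icc a b) t := by
  obtain ⟨C₀, hC₀, hMC⟩ := Matrix.exists_forall_abs_apply_le hM
  set C : ℝ := n * C₀ with hC
  have hCnn : 0 ≤ C := by positivity
  have hMC' : ∀ t ∈ Icc a b, ∀ x, ‖(M t).mulVec x‖ ≤ C * ‖x‖ := fun t ht x =>
    Matrix.norm_mulVec_le_of_abs_apply_le hC₀.le (hMC t ht) x
  -- The Gronwall bound for the untruncated equation on the whole interval.
  set R : ℝ := ‖x₀‖ * Real.exp (C * (b - a)) with hR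
  have hRnn : 0 ≤ R := by positivity
  -- truncating the argument makes the vector field bounded
  set cl : (Fin n → ℝ) → Fin n → ℝ := fun x i => max (-R) (min R (x i)) with hcl
  have cl_lip : ∀ x y, ‖cl x - cl y‖ ≤ ‖x - y‖ := fun x y => by
    refine (pi_norm_le_iff_of_nonneg (norm_nonneg _)).2 fun i => ?_
    refine le_trans ?_ (norm_le_pi_norm (x - y) i)
    simp only [hcl, Pi.sub_apply, Real.norm_eq_abs]
    refine (abs_max_sub_max_le_max _ _ _ _).trans ?_
    simp only [sub_self, abs_zero]
    refine max_le (abs_nonneg _) ((abs_min_sub_min_le_max _ _ _ _).trans ?_)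
    simp
  have cl_zero : cl 0 = 0 := by ext i; simp [hcl, hRnn]
  have cl_le : ∀ x, ‖cl x‖ ≤ ‖x‖ := fun x => by simpa [cl_zero] using cl_lip x 0
  have cl_le' : ∀ x, ‖cl x‖ ≤ R := fun x => by
    refine (pi_norm_le_iff_of_nonneg hRnn).2 fun i => ?_
    rw [Real.norm_eq_abs, abs_le]
    exact ⟨le_max_left _ _, max_le (by linarith) (min_le_left _ _)⟩
  have cl_eq : ∀ x, ‖x‖ ≤ R → cl x = x := fun x hx => by
    ext i
    have := abs_le.1 ((norm_le_pi_norm x i).trans hx)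
    simp only [hcl]
    rw [min_eq_right this.2, max_eq_right this.1]
  -- The truncated field has norm at most `C * R` everywhere, so a ball of radius `C * R * (b - a)`
  -- suffices for existence up to `b`.
  have hPL : IsPicardLindelof (fun t x => (M t).mulVec (cl x)) (tmin := a) (tmax := b)
      ⟨a, left_mem_Icc.2 hab⟩ x₀ ⟨C * R * (b - a), mul_nonneg (by positivity) (by linarith)⟩ 0
      ⟨C * R, by positivity⟩ ⟨C, hCnn⟩ := by
    constructor
    · intro t ht
      refine LipschitzWith.lipschitzOnWith (LipschitzWith.of_dist_le_mul fun x y => ?_)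
      rw [dist_eq_norm, dist_eq_norm, ← Matrix.mulVec_sub]
      exact (hMC' t ht _).trans (mul_le_mul_of_nonneg_left (cl_lip x y) hCnn)
    · intro x _
      refine continuousOn_pi.2 fun i => ?_
      simp only [Matrix.mulVec, dotProduct]
      refine continuousOn_finsetSum _ fun j _ => ContinuousOn.mul ?_ continuousOn_const
      exact continuousOn_pi.1 (continuousOn_pi.1 hM i) j
    · intro t ht x _
      exact (hMC' t ht _).trans (mul_le_mul_of_nonneg_left (cl_le' x) hCnn)
    · simp only [sub_self, max_eq_left (sub_nonneg.2 hab), NNReal.coe_zero, sub_zero]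
      exact le_of_eq rfl
  obtain ⟨y, hy₀, hy⟩ := hPL.exists_eq_forall_mem_Icc_hasDerivWithinAt₀
  refine ⟨y, hy₀, fun t ht => ?_⟩
  -- Since `‖cl x‖ ≤ ‖x‖`, the truncated solution obeys the same Gronwall bound; it never leaves the
  -- region where `cl` is the identity, so it solves the original equation.
  have hbound : ‖y t‖ ≤ R := by
    have := norm_le_gronwallBound_of_norm_deriv_right_le (δ := ‖x₀‖) (K := C) (ε := 0)
      (fun t ht => (hy t ht).continuousWithinAt)
      (fun t ht => (hy t (Ico_subset_Icc_self ht)).mono_of_mem_nhdsWithin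
        (Icc_mem_nhdsGE_of_mem ht))
      (by rw [show y a = x₀ from hy₀])
      (fun t ht => by
        rw [add_zero]
        exact (hMC' t (Ico_subset_Icc_self ht) _).trans
          (mul_le_mul_of_nonneg_left (cl_le _) hCnn)) t ht
    rw [gronwallBound_ε0] at this
    refine this.trans ?_
    rw [hR]
    gcongr
    exact ht.2
  have := hy t ht
  rwa [cl_eq _ hbound] at this

/-- Existence of the state-transition matrix. -/
theorem exists_hasMatrixDerivOn_mul {n : ℕ} {M : ℝ → Matrix (Fin n) (Fin n) ℝ} {T : ℝ}
    (hT : 0 ≤ T) (hM : ContinuousOn M (Icc 0 T)) :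
    ∃ Ψ : ℝ → Matrix (Fin n) (Fin n) ℝ, Ψ 0 = 1 ∧ HasMatrixDerivOn T Ψ (fun τ => M τ * Ψ τ) := by
  choose y hy₀ hy using fun j : Fin n => exists_hasDerivWithinAt_mulVec hT hM (Pi.single j 1)
  refine ⟨fun t => Matrix.of fun i j => y j t i, ?_, fun τ hτ i j => ?_⟩
  · ext i j
    simp [hy₀, Matrix.one_apply, Pi.single_apply]
  · exact hasDerivWithinAt_pi.1 (hy j τ hτ) i

/-! ### Comparison for differential inequalities with Metzler coefficients -/

lemma hasDerivWithinAt_Icc_nonneg_of_le {f : ℝ → ℝ} {f' a b : ℝ} (hab : a < b)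
    (hf : HasDerivWithinAt f f' (Icc a b) a) (h : ∀ t ∈ Ioc a b, f a ≤ f t) : 0 ≤ f' := by
  have h1 := hf.mono (Ioc_subset_Icc_self)
  rw [hasDerivWithinAt_iff_tendsto_slope' (by simp)] at h1
  have := left_nhdsWithin_Ioc_neBot hab
  refine ge_of_tendsto h1 (eventually_mem_nhdsWithin.mono fun t ht => ?_)
  rw [slope_def_field]
  exact div_nonneg (sub_nonneg.2 (h t ht)) (sub_nonneg.2 ht.1.le)

lemma hasDerivWithinAt_Icc_nonpos_of_le {f : ℝ → ℝ} {f' a b : ℝ} (hab : a < b)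
    (hf : HasDerivWithinAt f f' (Icc a b) b) (h : ∀ t ∈ Ico a b, f b ≤ f t) : f' ≤ 0 := by
  have h1 := hf.mono (Ico_subset_Icc_self)
  rw [hasDerivWithinAt_iff_tendsto_slope' (by simp)] at h1
  have := right_nhdsWithin_Ico_neBot hab
  refine le_of_tendsto h1 (eventually_mem_nhdsWithin.mono fun t ht => ?_)
  rw [slope_def_field]
  exact div_nonpos_of_nonneg_of_nonpos (sub_nonneg.2 (h t ht)) (sub_nonpos.2 ht.2.le)

/-- A function satisfying a strict linear differential inequality with Metzler coefficients
stays positive. -/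
theorem Matrix.IsMetzler.pos_of_strict_deriv {n : ℕ} {M : ℝ → Matrix (Fin n) (Fin n) ℝ}
    {w w' : ℝ → Fin n → ℝ} {a b : ℝ} (hM : ∀ t ∈ Ioc a b, (M t).IsMetzler)
    (hw : ∀ i, ContinuousOn (fun t => w t i) (Icc a b))
    (hd : ∀ t ∈ Ioc a b, ∀ i, HasDerivWithinAt (fun t => w t i) (w' t i) (Icc a b) t)
    (hlt : ∀ t ∈ Ioc a b, ∀ i, (M t).mulVec (w t) i < w' t i) (h₀ : ∀ i, 0 < w a i) :
    ∀ t ∈ Icc a b, ∀ i, 0 < w t i := by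
  by_contra! hbad
  obtain ⟨t₀, ht₀, i₀, hi₀⟩ := hbad
  set S : Set ℝ := ⋃ i, Icc a b ∩ (fun t => w t i) ⁻¹' Iic 0 with hS
  have hSc : IsClosed S :=
    isClosed_iUnion_of_finite fun i => (hw i).preimage_isClosed_of_isClosed isClosed_Icc isClosed_Iic
  have hSsub : S ⊆ Icc a b := iUnion_subset fun i => inter_subset_left
  -- The first time at which some coordinate is nonpositive. That coordinate vanishes there, having
  -- been positive before, so its left derivative is at most zero; the Metzler property makes the
  -- right-hand side nonnegative, against the strict inequality.
  obtain ⟨t, htS, htmin⟩ := (isCompact_Icc.of_isClosed_subset hSc hSsub).exists_isLeast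
    ⟨t₀, mem_iUnion.2 ⟨i₀, ht₀, hi₀⟩⟩
  obtain ⟨i, ht, hi⟩ := mem_iUnion.1 htS
  have hi : w t i ≤ 0 := hi
  have hat : a < t := lt_of_le_of_ne ht.1 (by rintro rfl; exact absurd (h₀ i) (not_lt.2 hi))
  have hpos : ∀ r ∈ Ico a t, ∀ j, 0 < w r j := by
    intro r hr j
    by_contra! h
    exact absurd (htmin (mem_iUnion.2 ⟨j, ⟨hr.1, hr.2.le.trans ht.2⟩, h⟩)) (not_le.2 hr.2)
  have hnn : ∀ j, 0 ≤ w t j := by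
    intro j
    have := right_nhdsWithin_Ico_neBot hat
    exact ge_of_tendsto (((hw j) t ht).mono (Ico_subset_Icc_self.trans (Icc_subset_Icc_right ht.2)))
      (eventually_mem_nhdsWithin.mono fun r hr => (hpos r hr j).le)
  have hi0 : w t i = 0 := le_antisymm hi (hnn i)
  have hMw : 0 ≤ (M t).mulVec (w t) i := by
    rw [Matrix.mulVec, dotProduct]
    refine Finset.sum_nonneg fun j _ => ?_
    rcases eq_or_ne i j with rfl | hij
    · simp [hi0]
    · exact mul_nonneg (hM t ⟨hat, ht.2⟩ i j hij) (hnn j)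
  have hder := hasDerivWithinAt_Icc_nonpos_of_le hat
    ((hd t ⟨hat, ht.2⟩ i).mono (Icc_subset_Icc_right ht.2))
    (fun r hr => by rw [hi0]; exact (hpos r hr i).le)
  linarith [hlt t ⟨hat, ht.2⟩ i]

/-- **Comparison principle** for linear differential inequalities with Metzler coefficients that
admit a positive strict supersolution `ξ`. -/
theorem Matrix.IsMetzler.nonneg_of_deriv {n : ℕ} {M : ℝ → Matrix (Fin n) (Fin n) ℝ}
    {z z' ξ ξ' : ℝ → Fin n → ℝ} {v : Fin n → ℝ} {a b : ℝ}
    (hM : ∀ t ∈ Ioo a b, (M t).IsMetzler)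
    (hξ : ∀ t ∈ Icc a b, ∀ i, HasDerivWithinAt (fun t => ξ t i) (ξ' t i) (Icc a b) t)
    (hξlt : ∀ t ∈ Ioo a b, ∀ i, (M t).mulVec (ξ t) i < ξ' t i)
    (hξpos : ∀ t ∈ Icc a b, ∀ i, 0 < ξ t i)
    (hz : ∀ t ∈ Ioo a b, ∀ i, HasDerivAt (fun t => z t i) (z' t i) t)
    (hzle : ∀ t ∈ Ioo a b, ∀ i, (M t).mulVec (z t) i ≤ z' t i)
    (hlim : Tendsto z (𝓝[>] a) (𝓝 v)) (hv : ∀ i, 0 ≤ v i)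
    (hb : ContinuousWithinAt z (Iic b) b) :
    ∀ t ∈ Ioc a b, ∀ i, 0 ≤ z t i := by
  -- Adding `δ ξ` makes the inequality and the initial positivity strict. As `z` has only a right
  -- limit at `a`, the strict result is applied from a time `r` slightly later than `a`.
  have key : ∀ t ∈ Ioo a b, ∀ i, ∀ δ > 0, 0 ≤ z t i + δ * ξ t i := by
    intro t ht i δ hδ
    have ha : a ∈ Icc a b := ⟨le_rfl, ht.1.le.trans ht.2.le⟩
    have hab : a < b := ht.1.trans ht.2
    have hev : ∀ᶠ r in 𝓝[>] a, (∀ j, 0 < z r j + δ * ξ r j) ∧ r ∈ Ioo a t := by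
      refine Filter.Eventually.and ?_ (Ioo_mem_nhdsGT ht.1)
      rw [eventually_all]
      intro j
      have h1 : Tendsto (fun r => ξ r j) (𝓝[>] a) (𝓝 (ξ a j)) :=
        ((hξ a ha j).continuousWithinAt.mono_of_mem_nhdsWithin
          (mem_of_superset (Ioc_mem_nhdsGT hab) Ioc_subset_Icc_self) :)
      have h2 : Tendsto (fun r => z r j + δ * ξ r j) (𝓝[>] a) (𝓝 (v j + δ * ξ a j)) :=
        ((tendsto_pi_nhds.1 hlim) j).add (h1.const_mul δ)
      exact h2.eventually_const_lt (by have := mul_pos hδ (hξpos a ha j); linarith [hv j])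
    obtain ⟨r, hr, har, hrt⟩ := hev.exists
    have hsub : Icc r t ⊆ Ioo a b := fun u hu => ⟨har.trans_le hu.1, hu.2.trans_lt ht.2⟩
    have hder : ∀ u ∈ Icc r t, ∀ j, HasDerivWithinAt (fun u => (z u + δ • ξ u) j)
        ((z' u + δ • ξ' u) j) (Icc r t) u := by
      intro u hu j
      simp only [Pi.add_apply, Pi.smul_apply, smul_eq_mul]
      exact (hz u (hsub hu) j).hasDerivWithinAt.add
        (((hξ u (Ioo_subset_Icc_self (hsub hu)) j).mono
          (hsub.trans Ioo_subset_Icc_self)).const_mul δ)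
    have := Matrix.IsMetzler.pos_of_strict_deriv (M := M) (w := fun u => z u + δ • ξ u)
      (w' := fun u => z' u + δ • ξ' u)
      (fun u hu => hM u (hsub (Ioc_subset_Icc_self hu)))
      (fun j u hu => (hder u hu j).continuousWithinAt)
      (fun u hu j => hder u (Ioc_subset_Icc_self hu) j)
      (fun u hu j => by
        have hu := hsub (Ioc_subset_Icc_self hu)
        rw [Matrix.mulVec_add, Matrix.mulVec_smul]
        simp only [Pi.add_apply, Pi.smul_apply, smul_eq_mul]
        have := mul_lt_mul_of_pos_left (hξlt u hu j) hδ
        linarith [hzle u hu j])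
      (fun j => by simpa using hr j) t (right_mem_Icc.2 hrt.le) i
    simpa using this.le
  have hIoo : ∀ t ∈ Ioo a b, ∀ i, 0 ≤ z t i := by
    intro t ht i
    have h : Tendsto (fun δ : ℝ => z t i + δ * ξ t i) (𝓝[>] 0) (𝓝 (z t i)) := by
      have : Continuous (fun δ : ℝ => z t i + δ * ξ t i) := by fun_prop
      simpa using (this.tendsto 0).mono_left nhdsWithin_le_nhds
    exact ge_of_tendsto h (eventually_mem_nhdsWithin.mono fun δ hδ => key t ht i δ hδ)
  intro t ht i
  rcases ht.2.lt_or_eq with h | rfl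
  · exact hIoo t ⟨ht.1, h⟩ i
  · have := right_nhdsWithin_Ioo_neBot ht.1
    have h1 : Tendsto z (𝓝[Ioo a t] t) (𝓝 (z t)) := hb.mono fun r hr => hr.2.le
    exact ge_of_tendsto ((tendsto_pi_nhds.1 h1) i)
      (eventually_mem_nhdsWithin.mono fun r hr => hIoo r hr i)

/-! ### Impulse times with constant dwell-time -/

namespace ConstantDwellTime

variable {T : ℝ} {t : ℕ → ℝ}

lemma apply_add (h : ConstantDwellTime T t) (k j : ℕ) : t (k + j) = t k + j * T := by
  induction j with
  | zero => simp
  | succ j ih =>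
    have := h (k + j)
    rw [← add_assoc]
    push_cast
    linarith

lemma apply_succ (h : ConstantDwellTime T t) (k : ℕ) : t (k + 1) = t k + T := by
  linarith [h k]

lemma strictMono (h : ConstantDwellTime T t) (hT : 0 < T) : StrictMono t :=
  strictMono_nat_of_lt_succ fun k => by linarith [h k]

lemma exists_mem_Ioc (h : ConstantDwellTime T t) (hT : 0 < T) {k : ℕ} {r : ℝ} (hr : t k < r) :
    ∃ j, r ∈ Ioc (t (k + j)) (t (k + j + 1)) := by
  classical
  have hex : ∃ j, r ≤ t (k + j + 1) := by
    obtain ⟨j, hj⟩ := exists_nat_ge ((r - t k) / T)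
    refine ⟨j, ?_⟩
    rw [div_le_iff₀ hT] at hj
    rw [h.apply_succ, h.apply_add]
    linarith
  refine ⟨Nat.find hex, ?_, Nat.find_spec hex⟩
  rcases Nat.eq_zero_or_pos (Nat.find hex) with h0 | h0
  · simpa [h0] using hr
  · have := Nat.find_min hex (Nat.sub_lt h0 one_pos)
    rw [add_assoc, show Nat.find hex - 1 + 1 = Nat.find hex from Nat.sub_add_cancel h0] at this
    exact not_le.1 this

lemma exists_mem_Ico (h : ConstantDwellTime T t) (hT : 0 < T) {s : ℝ} (hs : t 0 ≤ s) :
    ∃ k, s ∈ Ico (t k) (t (k + 1)) := by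
  rcases hs.eq_or_lt with rfl | hs
  · exact ⟨0, le_rfl, h.strictMono hT one_pos⟩
  · obtain ⟨j, hj1, hj2⟩ := h.exists_mem_Ioc hT hs
    rw [zero_add] at hj1 hj2
    rcases hj2.eq_or_lt with rfl | hj2
    · exact ⟨j + 1, le_rfl, h.strictMono hT (Nat.lt_succ_self _)⟩
    · exact ⟨j, hj1.le, hj2⟩

end ConstantDwellTime

namespace Matrix

lemma IsNonneg.mulVec_nonneg {m n : ℕ} {N : Matrix (Fin m) (Fin n) ℝ} (hN : N.IsNonneg)
    {v : Fin n → ℝ} (hv : ∀ i, 0 ≤ v i) (i : Fin m) : 0 ≤ N.mulVec v i := by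
  rw [mulVec, dotProduct]
  exact Finset.sum_nonneg fun j _ => mul_nonneg (hN i j) (hv j)

lemma IsNonneg.mul {l m n : ℕ} {N : Matrix (Fin l) (Fin m) ℝ} {P : Matrix (Fin m) (Fin n) ℝ}
    (hN : N.IsNonneg) (hP : P.IsNonneg) : (N * P).IsNonneg := fun i j => by
  rw [Matrix.mul_apply]
  exact Finset.sum_nonneg fun k _ => mul_nonneg (hN i k) (hP k j)

end Matrix

/-! ### Sufficiency: contractive supersolutions give positivity and exponential decay -/

namespace ImpulsiveSystem

variable {n mc md : ℕ} {S : ImpulsiveSystem n mc md} {T : ℝ}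
  {Kc : ℝ → Matrix (Fin mc) (Fin n) ℝ} {Kd : Matrix (Fin md) (Fin n) ℝ}

lemma IsClosedLoopTrajectory.hasDerivAt {t : ℕ → ℝ} {s : ℝ} {x : ℝ → Fin n → ℝ}
    (ht : StrictMono t) (hx : S.IsClosedLoopTrajectory Kc Kd t s x) {k : ℕ} {r : ℝ}
    (hsr : s < r) (hr : r ∈ Ioo (t k) (t (k + 1))) :
    HasDerivAt x ((S.A + S.Bc * Kc (r - t k)).mulVec (x r)) r := by
  obtain ⟨uc, ud, htr, huc, -⟩ := hx
  have hne : ∀ j, r ≠ t j := by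
    rintro j rfl
    have h1 := ht.lt_iff_lt.1 hr.1
    have h2 := ht.lt_iff_lt.1 hr.2
    omega
  have := htr.flow r hsr hne
  rwa [huc k r (Ioo_subset_Ioc_self hr) hsr.le, Matrix.mulVec_mulVec, ← Matrix.add_mulVec] at this

lemma IsClosedLoopTrajectory.tendsto_jump {t : ℕ → ℝ} {s : ℝ} {x : ℝ → Fin n → ℝ}
    (hx : S.IsClosedLoopTrajectory Kc Kd t s x) {k : ℕ} (hk : s ≤ t k) :
    Tendsto x (𝓝[>] (t k)) (𝓝 ((S.J + S.Bd * Kd).mulVec (x (t k)))) := by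
  obtain ⟨uc, ud, htr, -, hud⟩ := hx
  have := htr.jump k hk
  rwa [hud k hk, Matrix.mulVec_mulVec, ← Matrix.add_mulVec] at this

/-- A positive function on the clock interval that strictly dominates the closed-loop flow and is
contracted by a factor `ρ < 1` at the jumps. -/
structure IsContractiveSupersolution (S : ImpulsiveSystem n mc md) (T : ℝ)
    (Kc : ℝ → Matrix (Fin mc) (Fin n) ℝ) (Kd : Matrix (Fin md) (Fin n) ℝ)
    (ξ ξ' : ℝ → Fin n → ℝ) (ρ : ℝ) : Prop where
  metzler : ∀ τ ∈ Icc 0 T, (S.A + S.Bc * Kc τ).IsMetzler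
  nonneg : (S.J + S.Bd * Kd).IsNonneg
  pos : ∀ τ ∈ Icc 0 T, ∀ i, 0 < ξ τ i
  deriv : ∀ τ ∈ Icc 0 T, ∀ i, HasDerivWithinAt (fun σ => ξ σ i) (ξ' τ i) (Icc 0 T) τ
  flow : ∀ τ ∈ Icc 0 T, ∀ i, (S.A + S.Bc * Kc τ).mulVec (ξ τ) i < ξ' τ i
  rate_nonneg : 0 ≤ ρ
  rate_lt_one : ρ < 1
  jump : ∀ i, (S.J + S.Bd * Kd).mulVec (ξ T) i ≤ ρ * ξ 0 i

namespace IsContractiveSupersolution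

variable {ξ ξ' : ℝ → Fin n → ℝ} {ρ : ℝ}

/-- The comparison principle applies to `c ξ + σ x` between jumps. The sign `σ` lets one statement
serve both the lower and the upper bound on `x`. The right limit `v` replaces `x a` because `x` at
an impulse time is the state before the jump. -/
lemma segment (h : S.IsContractiveSupersolution T Kc Kd ξ ξ' ρ) (hT : 0 < T) {t : ℕ → ℝ}
    (ht : ConstantDwellTime T t) {s : ℝ} {x : ℝ → Fin n → ℝ}
    (hx : S.IsClosedLoopTrajectory Kc Kd t s x) {k : ℕ} {a : ℝ} (hka : t k ≤ a) (hsa : s ≤ a)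
    {v : Fin n → ℝ} (hlim : Tendsto x (𝓝[>] a) (𝓝 v)) {c σ : ℝ} (hc : 0 ≤ c)
    (hv : ∀ i, 0 ≤ c * ξ (a - t k) i + σ * v i) :
    ∀ r ∈ Ioc a (t (k + 1)), ∀ i, 0 ≤ c * ξ (r - t k) i + σ * x r i := by
  intro r₀ hr₀
  have hab : a < t (k + 1) := hr₀.1.trans_le hr₀.2
  have hmaps : MapsTo (fun r => r - t k) (Icc a (t (k + 1))) (Icc 0 T) := fun r hr =>
    ⟨by linarith [hr.1], by linarith [hr.2, ht.apply_succ k]⟩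
  have hξ : ∀ r ∈ Icc a (t (k + 1)), ∀ i,
      HasDerivWithinAt (fun r => ξ (r - t k) i) (ξ' (r - t k) i) (Icc a (t (k + 1))) r := by
    intro r hr i
    have := (h.deriv _ (hmaps hr) i).comp r ((hasDerivWithinAt_id r _).sub_const (t k)) hmaps
    rwa [mul_one] at this
  have hξc : ContinuousOn (fun r => ξ (r - t k)) (Icc a (t (k + 1))) :=
    continuousOn_pi.2 fun i r hr => (hξ r hr i).continuousWithinAt
  have hflow : ∀ r ∈ Ioo a (t (k + 1)), ∀ i, HasDerivAt (fun r => x r i)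
      ((S.A + S.Bc * Kc (r - t k)).mulVec (x r) i) r := fun r hr i =>
    hasDerivAt_pi.1 (hx.hasDerivAt (ht.strictMono hT) (hsa.trans_lt hr.1)
      ⟨hka.trans_lt hr.1, hr.2⟩) i
  have hleft : ContinuousWithinAt x (Iic (t (k + 1))) (t (k + 1)) := by
    obtain ⟨uc, ud, htr, -⟩ := hx
    exact htr.left_cont _ (hsa.trans_lt hab)
  refine Matrix.IsMetzler.nonneg_of_deriv (M := fun r => S.A + S.Bc * Kc (r - t k))
    (z := fun r => c • ξ (r - t k) + σ • x r)
    (z' := fun r => c • ξ' (r - t k) + σ • (S.A + S.Bc * Kc (r - t k)).mulVec (x r))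
    (v := c • ξ (a - t k) + σ • v)
    (fun r hr => h.metzler _ (hmaps (Ioo_subset_Icc_self hr))) hξ
    (fun r hr => h.flow _ (hmaps (Ioo_subset_Icc_self hr)))
    (fun r hr => h.pos _ (hmaps hr)) ?_ ?_ ?_ hv ?_ r₀ hr₀
  · intro r hr i
    exact (((hξ r (Ioo_subset_Icc_self hr) i).hasDerivAt (Icc_mem_nhds hr.1 hr.2)).const_mul
      c).add ((hflow r hr i).const_mul σ)
  · intro r hr i
    rw [Matrix.mulVec_add, Matrix.mulVec_smul, Matrix.mulVec_smul]
    simp only [Pi.add_apply, Pi.smul_apply, smul_eq_mul]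
    have := mul_le_mul_of_nonneg_left (h.flow _ (hmaps (Ioo_subset_Icc_self hr)) i).le hc
    linarith
  · refine Tendsto.add (Tendsto.const_smul ?_ c) (hlim.const_smul σ)
    exact (hξc a (left_mem_Icc.2 hab.le)).mono_of_mem_nhdsWithin
      (mem_of_superset (Ioc_mem_nhdsGT hab) Ioc_subset_Icc_self)
  · refine ContinuousWithinAt.add (ContinuousWithinAt.const_smul ?_ c) (hleft.const_smul σ)
    exact (hξc _ (right_mem_Icc.2 hab.le)).mono_of_mem_nhdsWithin (Icc_mem_nhdsLE hab)

/-- Apply the nonnegative jump matrix to `c ξ(T) + σ y`, then use the contraction of `ξ` at the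
jump. -/
lemma after_jump (h : S.IsContractiveSupersolution T Kc Kd ξ ξ' ρ) {c σ : ℝ} (hc : 0 ≤ c)
    {y : Fin n → ℝ} (hy : ∀ i, 0 ≤ c * ξ T i + σ * y i) (i : Fin n) :
    0 ≤ c * ρ * ξ 0 i + σ * (S.J + S.Bd * Kd).mulVec y i := by
  have h1 := h.nonneg.mulVec_nonneg (v := c • ξ T + σ • y) hy i
  rw [Matrix.mulVec_add, Matrix.mulVec_smul, Matrix.mulVec_smul] at h1
  simp only [Pi.add_apply, Pi.smul_apply, smul_eq_mul] at h1
  have := mul_le_mul_of_nonneg_left (h.jump i) hc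
  linarith

/-- Alternates `segment` and `after_jump`. The initial bound is assumed for every clock value
because the relevant one depends on `s`: it is `T` if `s` is an impulse time, where a jump comes
first, and `s - t k` otherwise. In the former case the factor `ρ` of that jump is discarded, so that
both cases start with exponent `0`. -/
lemma propagate (h : S.IsContractiveSupersolution T Kc Kd ξ ξ' ρ) (hT : 0 < T) {t : ℕ → ℝ}
    (ht : ConstantDwellTime T t) {s : ℝ} {x : ℝ → Fin n → ℝ}
    (hx : S.IsClosedLoopTrajectory Kc Kd t s x) {k : ℕ} (hs : s ∈ Ico (t k) (t (k + 1)))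
    {c σ : ℝ} (hc : 0 ≤ c) (h₀ : ∀ τ ∈ Icc 0 T, ∀ i, 0 ≤ c * ξ τ i + σ * x s i) (j : ℕ) :
    ∀ r ∈ Ioc (t (k + j)) (t (k + j + 1)), s < r → ∀ i,
      0 ≤ c * ρ ^ j * ξ (r - t (k + j)) i + σ * x r i := by
  have hmono := ht.strictMono hT
  induction j with
  | zero =>
    intro r hr hsr
    simp only [add_zero, pow_zero, mul_one] at hr ⊢
    rcases hs.1.eq_or_lt with hks | hks
    · refine h.segment hT ht hx le_rfl hks.ge (hx.tendsto_jump hks.ge) hc (fun i => ?_) r hr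
      have h1 := h.after_jump hc (h₀ T (right_mem_Icc.2 hT.le)) i
      have h2 : c * ρ * ξ 0 i ≤ c * ξ 0 i := by
        refine mul_le_mul_of_nonneg_right ?_ (h.pos 0 (left_mem_Icc.2 hT.le) i).le
        exact mul_le_of_le_one_right hc h.rate_lt_one.le
      rw [sub_self, hks]
      linarith
    · have hne : ∀ j, s ≠ t j := by
        rintro j rfl
        have h1 := hmono.lt_iff_lt.1 hks
        have h2 := hmono.lt_iff_lt.1 hs.2
        omega
      have hlim : Tendsto x (𝓝[>] s) (𝓝 (x s)) := by
        obtain ⟨uc, ud, htr, -⟩ := hx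
        exact (htr.start hne).mono Ioi_subset_Ici_self
      refine h.segment hT ht hx hs.1 le_rfl hlim hc (fun i => ?_) r ⟨hsr, hr.2⟩
      exact h₀ _ ⟨by linarith, by linarith [hs.2, ht.apply_succ k]⟩ i
  | succ j ih =>
    intro r hr _
    have hsj : s < t (k + j + 1) := hs.2.trans_le (hmono.monotone (by omega))
    have h1 := ih _ ⟨hmono (Nat.lt_succ_self _), le_rfl⟩ hsj
    rw [show t (k + j + 1) - t (k + j) = T from ht _] at h1
    have h2 := h.after_jump (mul_nonneg hc (pow_nonneg h.rate_nonneg j)) h1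
    have h3 := h.segment hT ht hx (k := k + j + 1) le_rfl hsj.le (hx.tendsto_jump hsj.le)
      (c := c * ρ ^ (j + 1)) (σ := σ) (mul_nonneg hc (pow_nonneg h.rate_nonneg _))
      (fun i => by rw [sub_self, pow_succ, ← mul_assoc]; exact h2 i)
    exact h3 r hr

lemma continuousOn (h : S.IsContractiveSupersolution T Kc Kd ξ ξ' ρ) :
    ContinuousOn ξ (Icc 0 T) :=
  continuousOn_pi.2 fun i τ hτ => (h.deriv τ hτ i).continuousWithinAt

/-- Compactness makes `ξ` comparable with `𝟙`, uniformly in the clock; this converts bounds in terms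
of `ξ` into bounds in norm. -/
lemma exists_bounds (h : S.IsContractiveSupersolution T Kc Kd ξ ξ' ρ) :
    ∃ K L : ℝ, 0 < K ∧ 0 < L ∧ ∀ τ ∈ Icc 0 T, ∀ i, 1 ≤ K * ξ τ i ∧ ξ τ i ≤ L := by
  have hinv : ContinuousOn (fun τ i => (ξ τ i)⁻¹) (Icc 0 T) :=
    continuousOn_pi.2 fun i => (continuousOn_pi.1 h.continuousOn i).inv₀
      fun τ hτ => (h.pos τ hτ i).ne'
  obtain ⟨K, hK⟩ := isCompact_Icc.exists_bound_of_continuousOn hinv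
  obtain ⟨L, hL⟩ := isCompact_Icc.exists_bound_of_continuousOn h.continuousOn
  refine ⟨max K 1, max L 1, by positivity, by positivity, fun τ hτ i => ⟨?_, ?_⟩⟩
  · have h1 := (le_abs_self _).trans ((norm_le_pi_norm (fun i => (ξ τ i)⁻¹) i).trans (hK τ hτ))
    have h2 := h.pos τ hτ i
    calc (1 : ℝ) = (ξ τ i)⁻¹ * ξ τ i := (inv_mul_cancel₀ h2.ne').symm
      _ ≤ max K 1 * ξ τ i := by gcongr; exact h1.trans (le_max_left _ _)
  · exact ((le_abs_self _).trans ((norm_le_pi_norm (ξ τ) i).trans (hL τ hτ))).trans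
      (le_max_left _ _)

theorem closedLoopPositive (h : S.IsContractiveSupersolution T Kc Kd ξ ξ' ρ) (hT : 0 < T) :
    S.ClosedLoopPositive T Kc Kd := by
  intro t ht s hs x hx hxs r hr i
  rcases hr.eq_or_lt with rfl | hr
  · exact hxs i
  obtain ⟨k, hk⟩ := ht.exists_mem_Ico hT hs
  obtain ⟨j, hj⟩ := ht.exists_mem_Ioc hT (hk.1.trans_lt hr)
  -- With `c = 0` the supersolution drops out and the propagated inequality is `0 ≤ x`.
  have := h.propagate hT ht hx hk (c := 0) (σ := 1) le_rfl
    (fun τ _ i => by simpa using hxs i) j r hj hr i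
  simpa using this

/-- Exponential decay of the closed-loop trajectories, with constants that do not depend on the
trajectory. -/
lemma exists_norm_le (h : S.IsContractiveSupersolution T Kc Kd ξ ξ' ρ) (hT : 0 < T) :
    ∃ C > 0, ∀ t, ConstantDwellTime T t → ∀ s k, s ∈ Ico (t k) (t (k + 1)) → ∀ x,
      S.IsClosedLoopTrajectory Kc Kd t s x → ∀ j, ∀ r ∈ Ioc (t (k + j)) (t (k + j + 1)), s < r →
        ‖x r‖ ≤ C * ‖x s‖ * ρ ^ j := by
  obtain ⟨K, L, hK, hL, hKL⟩ := h.exists_bounds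
  refine ⟨K * L, by positivity, fun t ht s k hs x hx j r hr hsr => ?_⟩
  have hρ := pow_nonneg h.rate_nonneg j
  have hc : 0 ≤ K * ‖x s‖ := by positivity
  have hξx : ∀ τ ∈ Icc 0 T, ∀ i, |x s i| ≤ K * ‖x s‖ * ξ τ i := fun τ hτ i =>
    calc |x s i| ≤ ‖x s‖ * 1 := by simpa using norm_le_pi_norm (x s) i
      _ ≤ ‖x s‖ * (K * ξ τ i) := by gcongr; exact (hKL τ hτ i).1
      _ = _ := by ring
  refine (pi_norm_le_iff_of_nonneg (by positivity)).2 fun i => ?_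
  have h1 := h.propagate hT ht hx hs (σ := 1) hc
    (fun τ hτ i => by linarith [neg_abs_le (x s i), hξx τ hτ i]) j r hr hsr i
  have h2 := h.propagate hT ht hx hs (σ := -1) hc
    (fun τ hτ i => by linarith [le_abs_self (x s i), hξx τ hτ i]) j r hr hsr i
  have hmem : r - t (k + j) ∈ Icc 0 T :=
    ⟨by linarith [hr.1], by linarith [hr.2, ht.apply_succ (k + j)]⟩
  have h3 : K * ‖x s‖ * ρ ^ j * ξ (r - t (k + j)) i ≤ K * ‖x s‖ * ρ ^ j * L :=
    mul_le_mul_of_nonneg_left (hKL _ hmem i).2 (by positivity)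
  rw [Real.norm_eq_abs, abs_le]
  constructor <;> linarith

theorem closedLoopAsymptoticallyStable (h : S.IsContractiveSupersolution T Kc Kd ξ ξ' ρ)
    (hT : 0 < T) : S.ClosedLoopAsymptoticallyStable T Kc Kd := by
  obtain ⟨C, hC, hdecay⟩ := h.exists_norm_le hT
  intro t ht s hs
  obtain ⟨k, hk⟩ := ht.exists_mem_Ico hT hs
  -- The denominator `C + 1` also covers the time `r = s`, to which the decay estimate does not
  -- apply.
  refine ⟨fun ε hε => ⟨ε / (C + 1), by positivity, fun x hx hδ r hr => ?_⟩, fun x hx => ?_⟩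
  · rw [lt_div_iff₀ (by positivity)] at hδ
    have hn := norm_nonneg (x s)
    rcases hr.eq_or_lt with rfl | hr
    · nlinarith
    obtain ⟨j, hj⟩ := ht.exists_mem_Ioc hT (hk.1.trans_lt hr)
    have h1 := hdecay t ht s k hk x hx j r hj hr
    have h2 : C * ‖x s‖ * ρ ^ j ≤ C * ‖x s‖ :=
      mul_le_of_le_one_right (by positivity) (pow_le_one₀ h.rate_nonneg h.rate_lt_one.le)
    nlinarith
  · rw [Metric.tendsto_atTop]
    intro ε hε
    have hlim : Tendsto (fun j => C * ‖x s‖ * ρ ^ j) atTop (𝓝 0) := by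
      simpa using (tendsto_pow_atTop_nhds_zero_of_lt_one h.rate_nonneg h.rate_lt_one).const_mul
        (C * ‖x s‖)
    obtain ⟨j₀, hj₀⟩ := (hlim.eventually_lt_const hε).exists
    refine ⟨max (s + 1) (t (k + j₀) + 1), fun r hr => ?_⟩
    have hsr : s < r := by linarith [(le_max_left _ _).trans hr]
    have hr₀ : t (k + j₀) < r := by linarith [(le_max_right _ _).trans hr]
    obtain ⟨j, hj⟩ := ht.exists_mem_Ioc hT hr₀
    rw [dist_zero_right]
    rw [add_assoc] at hj
    refine (hdecay t ht s k hk x hx (j₀ + j) r hj hsr).trans_lt (lt_of_le_of_lt ?_ hj₀)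
    rw [pow_add, ← mul_assoc]
    exact mul_le_of_le_one_right (mul_nonneg (by positivity) (pow_nonneg h.rate_nonneg _))
      (pow_le_one₀ h.rate_nonneg h.rate_lt_one.le)

end IsContractiveSupersolution

end ImpulsiveSystem

/-! ### Solutions of the linear programs yield stabilizing gains -/

namespace ImpulsiveSystem

variable {n mc md : ℕ} {S : ImpulsiveSystem n mc md} {T : ℝ}

lemma continuousOn_add_mul {Kc : ℝ → Matrix (Fin mc) (Fin n) ℝ} {s : Set ℝ}
    (hKc : ContinuousOn Kc s) : ContinuousOn (fun τ => S.A + S.Bc * Kc τ) s :=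
  (continuous_const.add (continuous_const.matrix_mul continuous_id)).comp_continuousOn hKc

namespace ForwardLP

variable {X : ℝ → Matrix (Fin n) (Fin n) ℝ} {U : ℝ → Matrix (Fin mc) (Fin n) ℝ}
  {Ud : Matrix (Fin md) (Fin n) ℝ} {ε α : ℝ}

lemma eq_diagonal (h : S.ForwardLP T X U Ud ε α) {τ : ℝ} (hτ : τ ∈ Icc 0 T) :
    X τ = Matrix.diagonal fun i => X τ i i :=
  (h.diag τ hτ).diagonal_diag.symm

lemma continuousOn_apply (h : S.ForwardLP T X U Ud ε α) (i j : Fin n) :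
    ContinuousOn (fun τ => X τ i j) (Icc 0 T) := by
  obtain ⟨X', hX', -⟩ := h.flow
  exact fun τ hτ => (hX' τ hτ i j).continuousWithinAt

/-- A diagonal entry is positive at `0`; if it were nonpositive later it would vanish in between,
making the determinant of the diagonal matrix zero there. -/
lemma apply_pos (h : S.ForwardLP T X U Ud ε α) {τ : ℝ} (hτ : τ ∈ Icc 0 T) (i : Fin n) :
    0 < X τ i i := by
  by_contra! hneg
  obtain ⟨σ, hσ, h0⟩ := intermediate_value_Icc' hτ.1
    ((h.continuousOn_apply i i).mono (Icc_subset_Icc_right hτ.2)) ⟨hneg, (h.pos.2 i).le⟩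
  have hσ' : σ ∈ Icc 0 T := ⟨hσ.1, hσ.2.trans hτ.2⟩
  have hu := (Matrix.isUnit_iff_isUnit_det _).1 (h.invertible σ hσ')
  rw [h.eq_diagonal hσ', Matrix.det_diagonal] at hu
  exact hu.ne_zero (Finset.prod_eq_zero (Finset.mem_univ i) h0)

lemma inv_mul_self (h : S.ForwardLP T X U Ud ε α) {τ : ℝ} (hτ : τ ∈ Icc 0 T) :
    (X τ)⁻¹ * X τ = 1 :=
  Matrix.nonsing_inv_mul _ ((Matrix.isUnit_iff_isUnit_det _).1 (h.invertible τ hτ))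

lemma mulVec_one (h : S.ForwardLP T X U Ud ε α) {τ : ℝ} (hτ : τ ∈ Icc 0 T) :
    (X τ).mulVec 1 = fun i => X τ i i := by
  ext i
  rw [h.eq_diagonal hτ, Matrix.mulVec_diagonal]
  simp

lemma add_mul_mul (h : S.ForwardLP T X U Ud ε α) {τ : ℝ} (hτ : τ ∈ Icc 0 T) {m l : ℕ}
    (P : Matrix (Fin m) (Fin n) ℝ) (Q : Matrix (Fin m) (Fin l) ℝ) (V : Matrix (Fin l) (Fin n) ℝ) :
    (P + Q * (V * (X τ)⁻¹)) * X τ = P * X τ + Q * V := by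
  rw [Matrix.add_mul, Matrix.mul_assoc, Matrix.mul_assoc, h.inv_mul_self hτ, Matrix.mul_one]

lemma mul_apply (h : S.ForwardLP T X U Ud ε α) {τ : ℝ} (hτ : τ ∈ Icc 0 T) {m : ℕ}
    (P : Matrix (Fin m) (Fin n) ℝ) (i : Fin m) (j : Fin n) :
    (P * X τ) i j = P i j * X τ j j := by
  rw [h.eq_diagonal hτ, Matrix.mul_diagonal]
  simp

lemma exists_isContractiveSupersolution (h : S.ForwardLP T X U Ud ε α) (hT : 0 < T) :
    ∃ ξ ξ' ρ, S.IsContractiveSupersolution T (fun τ => U τ * (X τ)⁻¹) (Ud * (X T)⁻¹) ξ ξ' ρ := by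
  obtain ⟨X', hX', hlt⟩ := h.flow
  have h0 : (0 : ℝ) ∈ Icc 0 T := left_mem_Icc.2 hT.le
  have hTT : T ∈ Icc 0 T := right_mem_Icc.2 hT.le
  have hX'0 : ∀ τ ∈ Icc 0 T, ∀ i j, i ≠ j → X' τ i j = 0 := by
    intro τ hτ i j hij
    have h1 : HasDerivWithinAt (fun σ => X σ i j) 0 (Icc 0 T) τ :=
      (hasDerivWithinAt_const τ _ (0 : ℝ)).congr (fun σ hσ => h.diag σ hσ hij) (h.diag τ hτ hij)
    exact (uniqueDiffOn_Icc hT τ hτ).eq_deriv _ (hX' τ hτ i j) h1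
  set tr : ℝ := ∑ i, X 0 i i
  have hle : ∀ i, X 0 i i ≤ tr := fun i =>
    Finset.single_le_sum (f := fun i => X 0 i i) (fun j _ => (h.apply_pos h0 j).le)
      (Finset.mem_univ i)
  have htr0 : 0 ≤ tr := Finset.sum_nonneg fun j _ => (h.apply_pos h0 j).le
  have hε := h.eps_pos
  -- Every `X 0 i i` is at most the trace `tr`, so subtracting `ε` subtracts at least the fraction
  -- `ε / (tr + ε)` of each entry. The summand `ε` keeps the denominator positive even in dimension
  -- zero.
  refine ⟨fun τ i => X τ i i, fun τ i => X' τ i i, 1 - ε / (tr + ε), ?_⟩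
  constructor
  · intro τ hτ i j hij
    have h1 := h.metzler τ hτ i j
    rw [← h.add_mul_mul hτ, Matrix.add_apply, Matrix.smul_apply, Matrix.one_apply_ne hij,
      smul_zero, add_zero, h.mul_apply hτ] at h1
    exact nonneg_of_mul_nonneg_left h1 (h.apply_pos hτ j)
  · intro i j
    have h1 := h.nonneg i j
    rw [← h.add_mul_mul hTT, h.mul_apply hTT] at h1
    exact nonneg_of_mul_nonneg_left h1 (h.apply_pos hTT j)
  · exact fun τ hτ i => h.apply_pos hτ i
  · exact fun τ hτ i => hX' τ hτ i i
  · intro τ hτ i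
    have h1 := hlt τ hτ i
    have h2 : (X' τ).mulVec 1 i = X' τ i i := by
      rw [Matrix.mulVec, dotProduct, Finset.sum_eq_single i]
      · simp
      · intro j _ hj
        simp [hX'0 τ hτ i j hj.symm]
      · simp
    rw [add_assoc, ← h.add_mul_mul hτ, Matrix.add_mulVec, Matrix.neg_mulVec,
      ← Matrix.mulVec_mulVec, h.mulVec_one hτ, Pi.add_apply, Pi.neg_apply, h2] at h1
    linarith
  · rw [sub_nonneg, div_le_one (by positivity)]
    linarith
  · have : 0 < ε / (tr + ε) := by positivity
    linarith
  · intro i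
    have h1 := h.jump i
    rw [← h.add_mul_mul hTT, Matrix.add_mulVec, Matrix.sub_mulVec, Matrix.smul_mulVec,
      Matrix.one_mulVec, ← Matrix.mulVec_mulVec, h.mulVec_one hTT, h.mulVec_one h0] at h1
    simp only [Pi.add_apply, Pi.sub_apply, Pi.smul_apply, Pi.one_apply, smul_eq_mul,
      mul_one] at h1
    have h2 : ε / (tr + ε) * X 0 i i ≤ ε := by
      rw [div_mul_eq_mul_div, div_le_iff₀ (by positivity)]
      exact mul_le_mul_of_nonneg_left (by linarith [hle i]) hε.le
    linarith

lemma continuousOn_gain (h : S.ForwardLP T X U Ud ε α) :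
    ContinuousOn (fun τ => U τ * (X τ)⁻¹) (Icc 0 T) := by
  -- Inverting a diagonal matrix inverts its entries, which are continuous and positive.
  have key : ContinuousOn (fun τ => (Matrix.of fun i j => U τ i j * (X τ j j)⁻¹ :
      Matrix (Fin mc) (Fin n) ℝ)) (Icc 0 T) := by
    refine continuousOn_pi.2 fun i => continuousOn_pi.2 fun j => ?_
    exact (continuousOn_pi.1 (continuousOn_pi.1 h.cont i) j).mul
      ((h.continuousOn_apply j j).inv₀ fun τ hτ => (h.apply_pos hτ j).ne')
  refine key.congr fun τ hτ => ?_
  have hinv : (X τ)⁻¹ = Matrix.diagonal fun i => (X τ i i)⁻¹ := by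
    refine Matrix.inv_eq_left_inv ?_
    rw [h.eq_diagonal hτ, Matrix.diagonal_mul_diagonal, ← Matrix.diagonal_one]
    congr 1
    ext i
    simp [(h.apply_pos hτ i).ne']
  ext i j
  simp only [hinv, Matrix.mul_diagonal, Matrix.of_apply]

theorem isStabilizing (h : S.ForwardLP T X U Ud ε α) (hT : 0 < T) :
    S.IsStabilizing T (fun τ => U τ * (X τ)⁻¹) (Ud * (X T)⁻¹) := by
  obtain ⟨ξ, ξ', ρ, hξ⟩ := h.exists_isContractiveSupersolution hT
  exact ⟨h.continuousOn_gain, hξ.closedLoopPositive hT, hξ.closedLoopAsymptoticallyStable hT⟩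

end ForwardLP

/-! ### Clock reversal -/

lemma mapsTo_sub_Icc : MapsTo (fun τ => T - τ) (Icc 0 T) (Icc 0 T) := fun τ hτ =>
  ⟨by linarith [hτ.2], by linarith [hτ.1]⟩

lemma hasMatrixDerivOn_reverse {m l : ℕ} {X X' : ℝ → Matrix (Fin m) (Fin l) ℝ}
    (h : HasMatrixDerivOn T X X') :
    HasMatrixDerivOn T (fun τ => X (T - τ)) (fun τ => -X' (T - τ)) := by
  intro τ hτ i j
  have := (h (T - τ) (mapsTo_sub_Icc hτ) i j).comp τ
    ((hasDerivWithinAt_id τ (Icc 0 T)).const_sub T) mapsTo_sub_Icc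
  rwa [mul_neg_one] at this

/-- Reversing the clock turns solutions of one linear program into solutions of the other. -/
lemma BackwardLP.reverse {X : ℝ → Matrix (Fin n) (Fin n) ℝ}
    {U : ℝ → Matrix (Fin mc) (Fin n) ℝ} {Ud : Matrix (Fin md) (Fin n) ℝ} {ε α : ℝ}
    (h : S.BackwardLP T X U Ud ε α) :
    S.ForwardLP T (fun τ => X (T - τ)) (fun τ => U (T - τ)) Ud ε α where
  eps_pos := h.eps_pos
  alpha_pos := h.alpha_pos
  diag τ hτ := h.diag _ (mapsTo_sub_Icc hτ)
  invertible τ hτ := h.invertible _ (mapsTo_sub_Icc hτ)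
  pos := by simpa using h.pos
  cont := h.cont.comp (by fun_prop) mapsTo_sub_Icc
  metzler τ hτ := h.metzler _ (mapsTo_sub_Icc hτ)
  nonneg := by simpa using h.nonneg
  flow := by
    obtain ⟨X', hX', hlt⟩ := h.flow
    refine ⟨_, hasMatrixDerivOn_reverse hX', fun τ hτ i => ?_⟩
    rw [neg_neg]
    exact hlt _ (mapsTo_sub_Icc hτ) i
  jump := by simpa using h.jump

lemma ForwardLP.reverse {X : ℝ → Matrix (Fin n) (Fin n) ℝ}
    {U : ℝ → Matrix (Fin mc) (Fin n) ℝ} {Ud : Matrix (Fin md) (Fin n) ℝ} {ε α : ℝ}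
    (h : S.ForwardLP T X U Ud ε α) :
    S.BackwardLP T (fun τ => X (T - τ)) (fun τ => U (T - τ)) Ud ε α where
  eps_pos := h.eps_pos
  alpha_pos := h.alpha_pos
  diag τ hτ := h.diag _ (mapsTo_sub_Icc hτ)
  invertible τ hτ := h.invertible _ (mapsTo_sub_Icc hτ)
  pos := by simpa using h.pos
  cont := h.cont.comp (by fun_prop) mapsTo_sub_Icc
  metzler τ hτ := h.metzler _ (mapsTo_sub_Icc hτ)
  nonneg := by simpa using h.nonneg
  flow := by
    obtain ⟨X', hX', hlt⟩ := h.flow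
    refine ⟨_, hasMatrixDerivOn_reverse hX', fun τ hτ i => ?_⟩
    exact hlt _ (mapsTo_sub_Icc hτ) i
  jump := by simpa using h.jump

theorem BackwardLP.isStabilizing {X : ℝ → Matrix (Fin n) (Fin n) ℝ}
    {U : ℝ → Matrix (Fin mc) (Fin n) ℝ} {Ud : Matrix (Fin md) (Fin n) ℝ} {ε α : ℝ}
    (h : S.BackwardLP T X U Ud ε α) (hT : 0 < T) :
    S.IsStabilizing T (fun τ => U (T - τ) * (X (T - τ))⁻¹) (Ud * (X 0)⁻¹) := by
  simpa using h.reverse.isStabilizing hT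

/-! ### From the transition matrix to the linear program -/

/-- With continuous coefficients, `e^{cτ}𝟙` is a strict supersolution for large `c`. -/
lemma exists_exp_supersolution {M : ℝ → Matrix (Fin n) (Fin n) ℝ} (hM : ContinuousOn M (Icc 0 T)) :
    ∃ c : ℝ, ∀ τ ∈ Icc 0 T, ∀ i,
      (M τ).mulVec (Real.exp (c * τ) • 1) i < c * Real.exp (c * τ) := by
  obtain ⟨C, hC, hMC⟩ := Matrix.exists_forall_abs_apply_le hM
  refine ⟨n * C + 1, fun τ hτ i => ?_⟩
  have h1 : (M τ).mulVec 1 i ≤ n * C := by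
    have h2 := Matrix.norm_mulVec_le_of_abs_apply_le hC.le (hMC τ hτ) 1
    have h3 : ‖(1 : Fin n → ℝ)‖ ≤ 1 := (pi_norm_le_iff_of_nonneg zero_le_one).2 (by simp)
    calc (M τ).mulVec 1 i ≤ ‖(M τ).mulVec 1‖ := (le_abs_self _).trans (norm_le_pi_norm ((M τ).mulVec 1) i)
      _ ≤ n * C * ‖(1 : Fin n → ℝ)‖ := h2
      _ ≤ n * C := mul_le_of_le_one_right (by positivity) h3
  rw [Matrix.mulVec_smul, Pi.smul_apply, smul_eq_mul, mul_comm]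
  exact mul_lt_mul_of_pos_right (by linarith) (Real.exp_pos _)

lemma hasDerivWithinAt_exp_mul (c : ℝ) (s : Set ℝ) (τ : ℝ) :
    HasDerivWithinAt (fun σ => Real.exp (c * σ)) (c * Real.exp (c * τ)) s τ := by
  have := ((hasDerivAt_id τ).const_mul c).exp.hasDerivWithinAt (s := s)
  simpa [mul_comm] using this

lemma hasDerivWithinAt_mulVec_apply {M Ψ : ℝ → Matrix (Fin n) (Fin n) ℝ}
    (h : HasMatrixDerivOn T Ψ (fun τ => M τ * Ψ τ)) (v : Fin n → ℝ) {τ : ℝ} (hτ : τ ∈ Icc 0 T)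
    (i : Fin n) : HasDerivWithinAt (fun σ => (Ψ σ).mulVec v i)
      ((M τ).mulVec ((Ψ τ).mulVec v) i) (Icc 0 T) τ := by
  rw [Matrix.mulVec_mulVec]
  simp only [Matrix.mulVec, dotProduct]
  exact HasDerivWithinAt.fun_sum fun j _ => (h τ hτ i j).mul_const (v j)

theorem exists_forwardLP {lam : Fin n → ℝ} {Kc : ℝ → Matrix (Fin mc) (Fin n) ℝ}
    {Kd : Matrix (Fin md) (Fin n) ℝ} {Ψ : ℝ → Matrix (Fin n) (Fin n) ℝ} (hT : 0 < T)
    (hlam : ∀ i, 0 < lam i) (hKc : ContinuousOn Kc (Icc 0 T))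
    (hM : ∀ τ ∈ Icc 0 T, (S.A + S.Bc * Kc τ).IsMetzler) (hN : (S.J + S.Bd * Kd).IsNonneg)
    (hΨ : S.IsTransitionMatrix T Kc Ψ)
    (hlt : ∀ i, ((S.J + S.Bd * Kd) * Ψ T - 1).mulVec lam i < 0) :
    ∃ (X : ℝ → Matrix (Fin n) (Fin n) ℝ) (U : ℝ → Matrix (Fin mc) (Fin n) ℝ)
      (Ud : Matrix (Fin md) (Fin n) ℝ) (ε α : ℝ), S.ForwardLP T X U Ud ε α := by
  have hMc := continuousOn_add_mul (S := S) hKc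
  obtain ⟨c, hc⟩ := exists_exp_supersolution hMc
  set N := S.J + S.Bd * Kd with hNdef
  -- At `δ = 0` this is the strict inequality of (b), and it survives for small positive `δ`. The
  -- term in `exp (c * T)` is the contribution of the perturbation to `N ξ(T)`. The same `δ` later
  -- serves as `ε`.
  obtain ⟨δ, hδ, hδ0⟩ : ∃ δ : ℝ, (∀ i, (N * Ψ T).mulVec lam i +
      δ * (Real.exp (c * T) * N.mulVec 1 i + 1) < lam i) ∧ 0 < δ := by
    refine Filter.Eventually.exists (f := 𝓝[>] (0 : ℝ))
      (Filter.Eventually.and (eventually_all.2 fun i => ?_) eventually_mem_nhdsWithin)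
    have hcont : Continuous fun δ : ℝ => (N * Ψ T).mulVec lam i +
      δ * (Real.exp (c * T) * N.mulVec 1 i + 1) := by fun_prop
    refine ((hcont.tendsto 0).mono_left nhdsWithin_le_nhds).eventually_lt_const ?_
    have := hlt i
    rw [Matrix.sub_mulVec, Matrix.one_mulVec, Pi.sub_apply] at this
    linarith
  set ξ : ℝ → Fin n → ℝ := fun τ => (Ψ τ).mulVec lam + δ • Real.exp (c * τ) • 1 with hξ
  set ξ' : ℝ → Fin n → ℝ := fun τ i =>
    (S.A + S.Bc * Kc τ).mulVec ((Ψ τ).mulVec lam) i + δ * (c * Real.exp (c * τ)) with hξ'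
  have hder : ∀ τ ∈ Icc 0 T, ∀ i, HasDerivWithinAt (fun σ => ξ σ i) (ξ' τ i) (Icc 0 T) τ := by
    intro τ hτ i
    have := (hasDerivWithinAt_mulVec_apply hΨ.2 lam hτ i).add
      ((hasDerivWithinAt_exp_mul c (Icc 0 T) τ).const_mul δ)
    simpa [hξ, hξ'] using! this
  have hstrict : ∀ τ ∈ Icc 0 T, ∀ i, (S.A + S.Bc * Kc τ).mulVec (ξ τ) i < ξ' τ i := by
    intro τ hτ i
    simp only [hξ, hξ']
    rw [Matrix.mulVec_add, Matrix.mulVec_smul, Pi.add_apply, Pi.smul_apply, smul_eq_mul]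
    have := mul_lt_mul_of_pos_left (hc τ hτ i) hδ0
    linarith
  have hξ0 : ∀ i, ξ 0 i = lam i + δ := fun i => by simp [hξ, hΨ.1]
  have hξc : ∀ i, ContinuousOn (fun τ => ξ τ i) (Icc 0 T) :=
    fun i τ hτ => (hder τ hτ i).continuousWithinAt
  have hξpos : ∀ τ ∈ Icc 0 T, ∀ i, 0 < ξ τ i :=
    Matrix.IsMetzler.pos_of_strict_deriv (M := fun τ => S.A + S.Bc * Kc τ)
      (fun τ hτ => hM τ (Ioc_subset_Icc_self hτ)) hξc
      (fun τ hτ => hder τ (Ioc_subset_Icc_self hτ))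
      (fun τ hτ => hstrict τ (Ioc_subset_Icc_self hτ))
      (fun i => by rw [hξ0]; linarith [hlam i])
  have hMX : ContinuousOn (fun τ => (S.A + S.Bc * Kc τ) * Matrix.diagonal (ξ τ)) (Icc 0 T) := by
    refine continuousOn_pi.2 fun i => continuousOn_pi.2 fun j => ?_
    simp only [Matrix.mul_diagonal]
    exact (continuousOn_pi.1 (continuousOn_pi.1 hMc i) j).mul (hξc j)
  -- Only the diagonal entries need the shift by `α`; the others are nonnegative by the Metzler
  -- property.
  obtain ⟨α, hα, hMα⟩ := Matrix.exists_forall_abs_apply_le hMX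
  have hgain : ∀ {m l : ℕ} (P : Matrix (Fin m) (Fin n) ℝ) (Q : Matrix (Fin m) (Fin l) ℝ)
      (K : Matrix (Fin l) (Fin n) ℝ) (Y : Matrix (Fin n) (Fin n) ℝ),
      P * Y + Q * (K * Y) = (P + Q * K) * Y := fun P Q K Y => by
    rw [Matrix.add_mul, Matrix.mul_assoc]
  have hdiag1 : ∀ v : Fin n → ℝ, (Matrix.diagonal v).mulVec 1 = v := fun v => by
    ext i
    simp [Matrix.mulVec_diagonal]
  refine ⟨fun τ => Matrix.diagonal (ξ τ), fun τ => Kc τ * Matrix.diagonal (ξ τ),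
    Kd * Matrix.diagonal (ξ T), δ, α, ?_⟩
  constructor
  · exact hδ0
  · exact hα
  · exact fun τ _ => Matrix.isDiag_diagonal _
  · intro τ hτ
    rw [Matrix.isUnit_iff_isUnit_det, Matrix.det_diagonal, isUnit_iff_ne_zero]
    exact Finset.prod_ne_zero_iff.2 fun i _ => (hξpos τ hτ i).ne'
  · exact ⟨Matrix.isDiag_diagonal _, fun i => by
      simpa using hξpos 0 (left_mem_Icc.2 hT.le) i⟩
  · refine continuousOn_pi.2 fun i => continuousOn_pi.2 fun j => ?_
    simp only [Matrix.mul_diagonal]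
    exact (continuousOn_pi.1 (continuousOn_pi.1 hKc i) j).mul (hξc j)
  · intro τ hτ i j
    rw [hgain, Matrix.add_apply, Matrix.smul_apply]
    rcases eq_or_ne i j with rfl | hij
    · rw [Matrix.one_apply_eq, smul_eq_mul, mul_one]
      linarith [(abs_le.1 (hMα τ hτ i i)).1]
    · rw [Matrix.one_apply_ne hij, smul_zero, add_zero, Matrix.mul_diagonal]
      exact mul_nonneg (hM τ hτ i j hij) (hξpos τ hτ j).le
  · intro i j
    rw [hgain, Matrix.mul_diagonal]
    exact mul_nonneg (hN i j) (hξpos T (right_mem_Icc.2 hT.le) j).le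
  · refine ⟨fun τ => Matrix.diagonal (ξ' τ), fun τ hτ i j => ?_, fun τ hτ i => ?_⟩
    · rcases eq_or_ne i j with rfl | hij
      · simpa using! hder τ hτ i
      · simpa [hij] using! hasDerivWithinAt_const τ (Icc 0 T) (0 : ℝ)
    · rw [add_assoc, hgain, Matrix.add_mulVec, Matrix.neg_mulVec, ← Matrix.mulVec_mulVec,
        hdiag1, hdiag1, Pi.add_apply, Pi.neg_apply]
      linarith [hstrict τ hτ i]
  · intro i
    rw [hgain, Matrix.add_mulVec, Matrix.sub_mulVec, Matrix.smul_mulVec, Matrix.one_mulVec,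
      ← Matrix.mulVec_mulVec, hdiag1, hdiag1]
    simp only [Pi.add_apply, Pi.sub_apply, Pi.smul_apply, Pi.one_apply, smul_eq_mul, mul_one]
    rw [hξ0]
    have h1 := hδ i
    have h2 : N.mulVec (ξ T) i =
        (N * Ψ T).mulVec lam i + δ * (Real.exp (c * T) * N.mulVec 1 i) := by
      simp only [hξ]
      rw [Matrix.mulVec_add, Matrix.mulVec_smul, Matrix.mulVec_smul, Matrix.mulVec_mulVec]
      simp
    rw [← hNdef, h2]
    linarith

end ImpulsiveSystem

/-! ### Nonnegative matrices with vanishing powers -/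

/-- A nonnegative matrix whose powers tend to zero has a positive, strictly contracted vector. -/
theorem Matrix.IsNonneg.exists_pos_mulVec_lt {n : ℕ} {P : Matrix (Fin n) (Fin n) ℝ}
    (hP : P.IsNonneg) (hlim : Tendsto (fun k : ℕ => (P ^ k).mulVec 1) atTop (𝓝 0)) :
    ∃ lam : Fin n → ℝ, (∀ i, 0 < lam i) ∧ ∀ i, (P - 1).mulVec lam i < 0 := by
  have hpow : ∀ k, (P ^ k).IsNonneg := by
    intro k
    induction k with
    | zero =>
      intro i j
      rw [pow_zero, Matrix.one_apply]
      split_ifs <;> norm_num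
    | succ k ih => rw [pow_succ]; exact ih.mul hP
  have hev : ∀ᶠ k : ℕ in atTop, ∀ i, (P ^ k).mulVec 1 i < 1 :=
    eventually_all.2 fun i => (tendsto_pi_nhds.1 hlim i).eventually_lt_const one_pos
  obtain ⟨m, hm, hm1⟩ := (hev.and (eventually_ge_atTop 1)).exists
  obtain ⟨m, rfl⟩ := Nat.exists_eq_add_of_le' hm1
  -- The sum telescopes: `(P - 1)` maps it to `P ^ (m + 1) 𝟙 - 𝟙`, which is negative by the choice
  -- of `m`. The term `k = 0` makes it positive.
  refine ⟨(∑ k ∈ Finset.range (m + 1), P ^ k).mulVec 1, fun i => ?_, fun i => ?_⟩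
  · rw [Finset.sum_range_succ', pow_zero, Matrix.add_mulVec, Matrix.one_mulVec, Pi.add_apply,
      Pi.one_apply]
    have hQ : (∑ k ∈ Finset.range m, P ^ (k + 1)).IsNonneg := fun i j => by
      rw [Matrix.sum_apply]
      exact Finset.sum_nonneg fun k _ => hpow _ i j
    have := hQ.mulVec_nonneg (v := 1) (fun _ => zero_le_one) i
    linarith
  · rw [Matrix.mulVec_mulVec, mul_geom_sum, Matrix.sub_mulVec, Matrix.one_mulVec, Pi.sub_apply,
      Pi.one_apply]
    linarith [hm i]

/-! ### Construction of closed-loop trajectories -/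

/-- The function that equals `f k (r - k T)` for `r` in the `k`-th clock interval
`(k T, (k + 1) T]`. -/
noncomputable def clockGlue {E : Type*} (T : ℝ) (f : ℕ → ℝ → E) (r : ℝ) : E :=
  f (⌈r / T⌉₊ - 1) (r - ((⌈r / T⌉₊ - 1 : ℕ) : ℝ) * T)

/-- The ceiling closes the clock intervals on the right, as left-continuity requires: an impulse
time belongs to the interval that it ends. -/
lemma ceil_div_sub_one {T : ℝ} (hT : 0 < T) {k : ℕ} {r : ℝ}
    (hr : r ∈ Ioc (k * T) ((k + 1) * T)) : ⌈r / T⌉₊ - 1 = k := by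
  have : ⌈r / T⌉₊ = k + 1 := by
    rw [Nat.ceil_eq_iff (by omega), lt_div_iff₀ hT, div_le_iff₀ hT]
    simpa using hr
  omega

lemma clockGlue_of_mem {E : Type*} {T : ℝ} (hT : 0 < T) (f : ℕ → ℝ → E) {k : ℕ} {r : ℝ}
    (hr : r ∈ Ioc (k * T) ((k + 1) * T)) : clockGlue T f r = f k (r - k * T) := by
  rw [clockGlue, ceil_div_sub_one hT hr]

lemma constantDwellTime_mul (T : ℝ) : ConstantDwellTime T fun k : ℕ => k * T := fun k => by
  push_cast
  ring

lemma exists_mem_Ioc_mul {T r : ℝ} (hT : 0 < T) (hr : 0 < r) :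
    ∃ k : ℕ, r ∈ Ioc (k * T) ((k + 1) * T) := by
  obtain ⟨k, hk⟩ := (constantDwellTime_mul T).exists_mem_Ioc hT (k := 0) (r := r) (by simpa)
  exact ⟨k, by simpa using hk⟩

namespace ImpulsiveSystem

variable {n mc md : ℕ} {S : ImpulsiveSystem n mc md} {T : ℝ}
  {Kc : ℝ → Matrix (Fin mc) (Fin n) ℝ} {Kd : Matrix (Fin md) (Fin n) ℝ}

/-- Solutions of the flow on the clock intervals that are linked by the jump map form a
trajectory. -/
theorem isClosedLoopTrajectory_clockGlue (hT : 0 < T) {s : ℝ} (hs : s ∈ Ioc 0 T)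
    {f : ℕ → ℝ → Fin n → ℝ} {a : ℕ → ℝ} (ha0 : a 0 = s) (ha : ∀ k, a (k + 1) = 0)
    (hf : ∀ k, ∀ τ ∈ Icc (a k) T,
      HasDerivWithinAt (f k) ((S.A + S.Bc * Kc τ).mulVec (f k τ)) (Icc (a k) T) τ)
    (hjump : ∀ k, f (k + 1) 0 = (S.J + S.Bd * Kd).mulVec (f k T)) :
    S.IsClosedLoopTrajectory Kc Kd (fun k : ℕ => k * T) s (clockGlue T f) := by
  set x := clockGlue T f with hx
  have hg : ∀ k, ∀ r ∈ Icc (a k + k * T) ((k + 1) * T),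
      HasDerivWithinAt (fun r => f k (r - k * T))
        ((S.A + S.Bc * Kc (r - k * T)).mulVec (f k (r - k * T)))
        (Icc (a k + k * T) ((k + 1) * T)) r := by
    intro k r hr
    have hmaps : MapsTo (fun r => r - k * T) (Icc (a k + k * T) ((k + 1) * T)) (Icc (a k) T) :=
      fun r hr => ⟨by linarith [hr.1], by linarith [hr.2]⟩
    have := (hf k _ (hmaps hr)).scomp r ((hasDerivWithinAt_id r _).sub_const (k * T)) hmaps
    rwa [one_smul] at this
  have hak : ∀ k : ℕ, ∀ r, r ∈ Ioc (k * T) ((k + 1) * T) → s < r → a k + k * T < r := by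
    intro k r hr hsr
    rcases k with _ | k
    · simpa [ha0] using hsr
    · rw [ha, zero_add]; exact hr.1
  have hxT : ∀ k : ℕ, x ((k + 1) * T) = f k T := by
    intro k
    rw [hx, clockGlue_of_mem hT f (k := k) ⟨by nlinarith, le_rfl⟩]
    congr 1
    ring
  refine ⟨fun r => (Kc (r - ((⌈r / T⌉₊ - 1 : ℕ) : ℝ) * T)).mulVec (x r),
    fun r => Kd.mulVec (x r), ⟨?_, ?_, ?_, ?_⟩, ?_, fun k _ => rfl⟩
  · intro r hsr hne
    obtain ⟨k, hk⟩ := exists_mem_Ioc_mul hT (hs.1.trans hsr)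
    have hk2 : r < (k + 1) * T := lt_of_le_of_ne hk.2 (by simpa using hne (k + 1))
    have hev : x =ᶠ[𝓝 r] fun r => f k (r - k * T) :=
      mem_of_superset (Ioo_mem_nhds hk.1 hk2) fun u hu =>
        clockGlue_of_mem hT f (Ioo_subset_Ioc_self hu)
    have hkr := hak k r hk hsr
    have := ((hg k r ⟨hkr.le, hk.2⟩).hasDerivAt (Icc_mem_nhds hkr hk2)).congr_of_eventuallyEq hev
    rw [← clockGlue_of_mem hT f hk, ← hx] at this
    rwa [ceil_div_sub_one hT hk, Matrix.mulVec_mulVec, ← Matrix.add_mulVec]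
  · intro r hsr
    obtain ⟨k, hk⟩ := exists_mem_Ioc_mul hT (hs.1.trans hsr)
    have hkr := hak k r hk hsr
    have h1 : ContinuousWithinAt (fun r => f k (r - k * T)) (Iic r) r :=
      ((hg k r ⟨hkr.le, hk.2⟩).continuousWithinAt.mono
        (Icc_subset_Icc_right hk.2)).mono_of_mem_nhdsWithin (Icc_mem_nhdsLE hkr)
    refine h1.congr_of_eventuallyEq ?_ (clockGlue_of_mem hT f hk)
    exact mem_of_superset (Ioc_mem_nhdsLE hk.1) fun u hu =>
      clockGlue_of_mem hT f ⟨hu.1, hu.2.trans hk.2⟩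
  · intro k hk
    -- The impulse at time `0` precedes `s`, so it imposes nothing.
    rcases k with _ | k
    · simp only [Nat.cast_zero, zero_mul] at hk
      exact absurd hs.1 (not_lt.2 hk)
    · have hlt : ((k + 1 : ℕ) : ℝ) * T < ((k + 1 : ℕ) + 1) * T := by nlinarith
      have h1 := (hg (k + 1) ((k + 1 : ℕ) * T) ⟨by rw [ha, zero_add], hlt.le⟩).continuousWithinAt
      rw [ha, zero_add] at h1
      have h2 : Tendsto (fun r => f (k + 1) (r - (k + 1 : ℕ) * T)) (𝓝[>] ((k + 1 : ℕ) * T))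
          (𝓝 (f (k + 1) 0)) := by
        have h3 := h1.mono_of_mem_nhdsWithin
          (mem_of_superset (Ioc_mem_nhdsGT hlt) Ioc_subset_Icc_self)
        rw [ContinuousWithinAt, sub_self] at h3
        exact h3
      have h4 := hxT k
      rw [hjump, ← h4, Matrix.add_mulVec, ← Matrix.mulVec_mulVec] at h2
      push_cast at h2 hlt ⊢
      refine h2.congr' ?_
      refine mem_of_superset (Ioc_mem_nhdsGT hlt) fun u hu => ?_
      have := clockGlue_of_mem hT f (k := k + 1) (r := u) (by simpa using hu)
      simpa using this.symm
  · intro hne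
    have hsT : s < T := lt_of_le_of_ne hs.2 (by simpa using hne 1)
    have hmem : ∀ u ∈ Icc s T, u ∈ Ioc (((0 : ℕ) : ℝ) * T) (((0 : ℕ) + 1) * T) := fun u hu => by
      simpa using (⟨hs.1.trans_le hu.1, hu.2⟩ : 0 < u ∧ u ≤ T)
    have h1 : ContinuousWithinAt (fun r => f 0 (r - (0 : ℕ) * T)) (Icc s T) s := by
      have := (hg 0 s (by simpa [ha0] using hs.2)).continuousWithinAt
      simpa [ha0] using this
    refine (h1.mono_of_mem_nhdsWithin (Icc_mem_nhdsGE hsT)).congr_of_eventuallyEq ?_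
      (clockGlue_of_mem hT f (hmem s ⟨le_rfl, hsT.le⟩))
    exact mem_of_superset (Icc_mem_nhdsGE hsT) fun u hu => clockGlue_of_mem hT f (hmem u hu)
  · intro k r hr _
    simp only at hr ⊢
    rw [ceil_div_sub_one hT (k := k) (by simpa using hr)]

/-- Every initial state at a time `s ∈ (0, T]` starts a closed-loop trajectory, which is described
by the state-transition matrix from the next impulse time on. -/
theorem exists_isClosedLoopTrajectory (hT : 0 < T) (hKc : ContinuousOn Kc (Icc 0 T))
    {Ψ : ℝ → Matrix (Fin n) (Fin n) ℝ} (hΨ : S.IsTransitionMatrix T Kc Ψ) {s : ℝ}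
    (hs : s ∈ Ioc 0 T) (x₀ : Fin n → ℝ) :
    ∃ x : ℝ → Fin n → ℝ, S.IsClosedLoopTrajectory Kc Kd (fun k : ℕ => k * T) s x ∧ x s = x₀ ∧
      HasDerivWithinAt x ((S.A + S.Bc * Kc s).mulVec x₀) (Icc s T) s ∧
      ∀ k : ℕ, x ((k + 2) * T) =
        (Ψ T).mulVec ((((S.J + S.Bd * Kd) * Ψ T) ^ k).mulVec ((S.J + S.Bd * Kd).mulVec (x T))) := by
  set N := S.J + S.Bd * Kd with hN
  have hsub : Icc s T ⊆ Icc 0 T := Icc_subset_Icc_left hs.1.le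
  obtain ⟨y, hy₀, hy⟩ := exists_hasDerivWithinAt_mulVec hs.2
    ((continuousOn_add_mul (S := S) hKc).mono hsub) x₀
  -- Segment `0` solves the flow on `[s, T]`; segment `k + 1` starts at clock `0` from the state
  -- after `k + 1` jumps.
  set f : ℕ → ℝ → Fin n → ℝ := fun k => Nat.casesOn k y
    fun k τ => (Ψ τ).mulVec (((N * Ψ T) ^ k).mulVec (N.mulVec (y T))) with hf
  set a : ℕ → ℝ := fun k => Nat.casesOn k s fun _ => 0 with ha
  have htraj : S.IsClosedLoopTrajectory Kc Kd (fun k : ℕ => k * T) s (clockGlue T f) := by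
    refine isClosedLoopTrajectory_clockGlue hT hs (a := a) rfl (fun _ => rfl) ?_ ?_
    · rintro (_ | k) τ hτ
      · exact hy τ hτ
      · exact hasDerivWithinAt_pi.2 fun i => hasDerivWithinAt_mulVec_apply hΨ.2 _ hτ i
    · rintro (_ | k)
      · simp [hf, hΨ.1, hN]
      · simp only [hf, hΨ.1, Matrix.one_mulVec]
        simp only [← hN, pow_succ', Matrix.mulVec_mulVec, Matrix.mul_assoc]
  have hxy : ∀ r ∈ Icc s T, clockGlue T f r = y r := fun r hr => by
    have := clockGlue_of_mem hT f (k := 0) (r := r)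
      (by simpa using (⟨hs.1.trans_le hr.1, hr.2⟩ : 0 < r ∧ r ≤ T))
    simpa [hf] using this
  have hs' : s ∈ Icc s T := left_mem_Icc.2 hs.2
  refine ⟨clockGlue T f, htraj, (hxy s hs').trans hy₀, ?_, fun k => ?_⟩
  · have := (hy s hs').congr hxy (hxy s hs')
    rwa [hy₀] at this
  -- The time `(k + 2) * T` is the right end of interval `k + 1`, so it is read there at clock value
  -- `T`.
  · rw [hxy T (right_mem_Icc.2 hs.2), clockGlue_of_mem hT f (k := k + 1)
      ⟨by push_cast; nlinarith, by push_cast; nlinarith⟩]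
    simp only [hf]
    congr 2
    push_cast
    ring

/-! ### Necessity -/

/-- Necessity: a positive and asymptotically stable closed loop satisfies the condition on the
state-transition matrix. -/
theorem IsStabilizing.exists_transition_condition (h : S.IsStabilizing T Kc Kd) (hT : 0 < T) :
    ∃ (lam : Fin n → ℝ) (Ψ : ℝ → Matrix (Fin n) (Fin n) ℝ),
      (∀ i, 0 < lam i) ∧ (∀ τ ∈ Icc 0 T, (S.A + S.Bc * Kc τ).IsMetzler) ∧
      (S.J + S.Bd * Kd).IsNonneg ∧ S.IsTransitionMatrix T Kc Ψ ∧
      ∀ i, ((S.J + S.Bd * Kd) * Ψ T - 1).mulVec lam i < 0 := by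
  obtain ⟨hKc, hpos, hstab⟩ := h
  have hMc := continuousOn_add_mul (S := S) hKc
  obtain ⟨Ψ, hΨ0, hΨd⟩ := exists_hasMatrixDerivOn_mul hT.le hMc
  have hΨ : S.IsTransitionMatrix T Kc Ψ := ⟨hΨ0, hΨd⟩
  have hdwell := constantDwellTime_mul T
  have hTT : T ∈ Ioc 0 T := right_mem_Ioc.2 hT
  have hsingle : ∀ j : Fin n, (0 : Fin n → ℝ) ≤ Pi.single j 1 := fun j =>
    Pi.single_nonneg.2 zero_le_one
  -- Starting at the impulse time `T` from the `j`-th unit vector, the right limit of the trajectory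
  -- is the `j`-th column of the jump matrix.
  have hN : (S.J + S.Bd * Kd).IsNonneg := by
    intro i j
    obtain ⟨x, hx, hxs, -, -⟩ :=
      exists_isClosedLoopTrajectory (Kd := Kd) hT hKc hΨ hTT (Pi.single j 1)
    have hlim := hx.tendsto_jump (k := 1) (by simp)
    simp only [Nat.cast_one, one_mul] at hlim
    have hxp := hpos _ hdwell T (by simpa using hT.le) x hx (by rw [hxs]; exact hsingle j)
    have := ge_of_tendsto ((tendsto_pi_nhds.1 hlim) i)
      (eventually_mem_nhdsWithin.mono fun r (hr : T < r) => hxp r hr.le i)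
    simpa [hxs] using this
  -- Starting between impulses from the `j`-th unit vector, coordinate `i` is zero and then stays
  -- nonnegative, so its right derivative, the `(i, j)` entry, is nonnegative. The end points, where
  -- jumps occur, follow by continuity.
  have hMIoo : ∀ τ ∈ Ioo 0 T, (S.A + S.Bc * Kc τ).IsMetzler := by
    intro τ hτ i j hij
    obtain ⟨x, hx, hxs, hxd, -⟩ :=
      exists_isClosedLoopTrajectory (Kd := Kd) hT hKc hΨ (Ioo_subset_Ioc_self hτ) (Pi.single j 1)
    have hxp := hpos _ hdwell τ (by simpa using hτ.1.le) x hx (by rw [hxs]; exact hsingle j)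
    have := hasDerivWithinAt_Icc_nonneg_of_le hτ.2 (hasDerivWithinAt_pi.1 hxd i)
      (fun r hr => by
        rw [hxs, Pi.single_eq_of_ne hij]
        exact hxp r hr.1.le i)
    simpa using this
  have hM : ∀ τ ∈ Icc 0 T, (S.A + S.Bc * Kc τ).IsMetzler := by
    intro τ hτ i j hij
    have hcl : τ ∈ closure (Ioo 0 T) := by rwa [closure_Ioo hT.ne]
    have := mem_closure_iff_nhdsWithin_neBot.1 hcl
    have hc := (continuousOn_pi.1 (continuousOn_pi.1 hMc i) j τ hτ).mono Ioo_subset_Icc_self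
    exact ge_of_tendsto hc (eventually_mem_nhdsWithin.mono fun r hr => hMIoo r hr i j hij)
  -- Each column of `Ψ` solves the flow from a unit vector, so comparison with `e^{cτ}𝟙` as
  -- supersolution applies.
  have hΨT : (Ψ T).IsNonneg := by
    intro i j
    obtain ⟨c, hc⟩ := exists_exp_supersolution hMc
    have hcol : ∀ τ ∈ Icc 0 T, HasDerivWithinAt (fun τ i => Ψ τ i j)
        (fun i => ((S.A + S.Bc * Kc τ) * Ψ τ) i j) (Icc 0 T) τ := fun τ hτ =>
      hasDerivWithinAt_pi.2 fun i => hΨd τ hτ i j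
    refine Matrix.IsMetzler.nonneg_of_deriv (M := fun τ => S.A + S.Bc * Kc τ)
      (ξ := fun τ => Real.exp (c * τ) • 1) (ξ' := fun τ _ => c * Real.exp (c * τ))
      (z := fun τ i => Ψ τ i j) (z' := fun τ i => ((S.A + S.Bc * Kc τ) * Ψ τ) i j)
      (v := fun i => Ψ 0 i j)
      (fun τ hτ => hMIoo τ hτ) (fun τ _ i => ?_) (fun τ hτ => hc τ (Ioo_subset_Icc_self hτ))
      (fun τ _ i => by simpa using Real.exp_pos _)
      (fun τ hτ i => (hΨd τ (Ioo_subset_Icc_self hτ) i j).hasDerivAt (Icc_mem_nhds hτ.1 hτ.2))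
      (fun τ _ i => le_rfl) ?_ (fun i => ?_) ?_ T hTT i
    · simpa using hasDerivWithinAt_exp_mul c (Icc 0 T) τ
    · exact (hcol 0 (left_mem_Icc.2 hT.le)).continuousWithinAt.mono_of_mem_nhdsWithin
        (mem_of_superset (Ioc_mem_nhdsGT hT) Ioc_subset_Icc_self)
    · rw [hΨ0, Matrix.one_apply]
      split_ifs <;> norm_num
    · exact (hcol T (right_mem_Icc.2 hT.le)).continuousWithinAt.mono_of_mem_nhdsWithin
        (Icc_mem_nhdsLE hT)
  set N := S.J + S.Bd * Kd with hNdef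
  -- Starting at `T` from `Ψ(T)𝟙` gives `N x((k + 2)T) = (N Ψ(T))^(k + 2) 𝟙`. Only convergence of
  -- trajectories is used here, not Lyapunov stability.
  have hpow : Tendsto (fun k : ℕ => ((N * Ψ T) ^ k).mulVec 1) atTop (𝓝 0) := by
    obtain ⟨x, hx, hxs, -, hxk⟩ :=
      exists_isClosedLoopTrajectory (Kd := Kd) hT hKc hΨ hTT ((Ψ T).mulVec 1)
    have hx0 := (hstab _ hdwell T (by simpa using hT.le)).2 x hx
    have htime : Tendsto (fun k : ℕ => ((k : ℝ) + 2) * T) atTop atTop :=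
      (tendsto_atTop_add_const_right _ _ tendsto_natCast_atTop_atTop).atTop_mul_const hT
    have hcont : Continuous fun v : Fin n → ℝ => N.mulVec v := by fun_prop
    have hlim := (hcont.tendsto 0).comp (hx0.comp htime)
    rw [Matrix.mulVec_zero] at hlim
    refine (tendsto_add_atTop_iff_nat 2).1 (hlim.congr fun k => ?_)
    simp only [Function.comp_apply]
    rw [hxk, hxs]
    simp only [← hNdef, Matrix.mulVec_mulVec]
    rw [pow_succ', pow_succ]
    simp only [Matrix.mul_assoc]
  obtain ⟨lam, hlam, hlt⟩ := (hN.mul hΨT).exists_pos_mulVec_lt hpow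
  exact ⟨lam, Ψ, hlam, hM, hN, hΨ, hlt⟩

end ImpulsiveSystem

theorem theorem7 {n mc md : ℕ} (S : ImpulsiveSystem n mc md) (T : ℝ) (hT : 0 < T) :
    List.TFAE
      [ -- (a) a positive and asymptotically stable closed loop
        ∃ (Kc : ℝ → Matrix (Fin mc) (Fin n) ℝ) (Kd : Matrix (Fin md) (Fin n) ℝ),
          S.IsStabilizing T Kc Kd,
        -- (b) the condition on the state-transition matrix
        ∃ (lam : Fin n → ℝ) (Kc : ℝ → Matrix (Fin mc) (Fin n) ℝ)
          (Kd : Matrix (Fin md) (Fin n) ℝ) (Ψ : ℝ → Matrix (Fin n) (Fin n) ℝ),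
          (∀ i, 0 < lam i) ∧ ContinuousOn Kc (Set.Icc 0 T) ∧
          (∀ τ ∈ Set.Icc 0 T, (S.A + S.Bc * Kc τ).IsMetzler) ∧
          (S.J + S.Bd * Kd).IsNonneg ∧
          S.IsTransitionMatrix T Kc Ψ ∧
          ∀ i, ((S.J + S.Bd * Kd) * Ψ T - 1).mulVec lam i < 0,
        -- (c) the linear program with positive initial value
        ∃ (X : ℝ → Matrix (Fin n) (Fin n) ℝ) (U : ℝ → Matrix (Fin mc) (Fin n) ℝ)
          (Ud : Matrix (Fin md) (Fin n) ℝ) (ε α : ℝ), S.ForwardLP T X U Ud ε α,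
        -- (d) the linear program with positive final value
        ∃ (X : ℝ → Matrix (Fin n) (Fin n) ℝ) (U : ℝ → Matrix (Fin mc) (Fin n) ℝ)
          (Ud : Matrix (Fin md) (Fin n) ℝ) (ε α : ℝ), S.BackwardLP T X U Ud ε α ] ∧
    -- suitable gains from (c)
    (∀ (X : ℝ → Matrix (Fin n) (Fin n) ℝ) (U : ℝ → Matrix (Fin mc) (Fin n) ℝ)
        (Ud : Matrix (Fin md) (Fin n) ℝ) (ε α : ℝ), S.ForwardLP T X U Ud ε α →
      S.IsStabilizing T (fun τ => U τ * (X τ)⁻¹) (Ud * (X T)⁻¹)) ∧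
    -- suitable gains from (d), whose clock runs backwards
    (∀ (X : ℝ → Matrix (Fin n) (Fin n) ℝ) (U : ℝ → Matrix (Fin mc) (Fin n) ℝ)
        (Ud : Matrix (Fin md) (Fin n) ℝ) (ε α : ℝ), S.BackwardLP T X U Ud ε α →
      S.IsStabilizing T (fun τ => U (T - τ) * (X (T - τ))⁻¹) (Ud * (X 0)⁻¹)) := by
  refine ⟨?_, fun X U Ud ε α h => h.isStabilizing hT, fun X U Ud ε α h => h.isStabilizing hT⟩
  tfae_have 1 → 2 := by
    rintro ⟨Kc, Kd, h⟩
    obtain ⟨lam, Ψ, hlam, hM, hN, hΨ, hlt⟩ := h.exists_transition_condition hT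
    exact ⟨lam, Kc, Kd, Ψ, hlam, h.1, hM, hN, hΨ, hlt⟩
  tfae_have 2 → 3 := by
    rintro ⟨lam, Kc, Kd, Ψ, hlam, hKc, hM, hN, hΨ, hlt⟩
    exact ImpulsiveSystem.exists_forwardLP hT hlam hKc hM hN hΨ hlt
  tfae_have 3 → 4 := by
    rintro ⟨X, U, Ud, ε, α, h⟩
    exact ⟨_, _, Ud, ε, α, h.reverse⟩
  tfae_have 4 → 1 := by
    rintro ⟨X, U, Ud, ε, α, h⟩
    exact ⟨_, _, h.isStabilizing hT⟩
  tfae_finish
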